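/- Let $M\in\mathbb N$ and $\gamma\ge1$. For $\alpha,\beta>0$ let $K_1(\beta)$ be the smallest constant such that $$\|u\|_\infty^2\le K_1(\beta)\Bigl(\int_0^{2\pi/\alpha}(u'^2+\alpha^2\beta u^2)\,dx\Bigr)^{1/2}\Bigl(\int_0^{2\pi/\alpha}u^2\,dx\Bigr)^{1/2}\qquad\text{for all } u\in H^1(0,2\pi/\alpha)_{\mathrm{per}}$$ (by scaling it does not depend on $\alpha$), and for $\delta\in[0,1)$ let $K_2(\delta)$ be the smallest constant such that $$\|u\|_\infty^2\le K_2(\delta)\Bigl(\int_0^{2\pi}(u'^2-\delta u^2)\,dx\Bigr)^{1/2}\Bigl(\int_0^{2\pi}u^2\,dx\Bigr)^{1/2}\qquad\text{for all } u\in H^1(0,2\pi)_{\mathrm{per}}\text{ with }\int_0^{2\pi}u\,dx=0.$$ Let $$\mathrm L^{\mathrm{cl}}_{\gamma,1}=\frac1{2\pi}\int_{\mathbb R}(1-\xi^2)_+^\gamma\,d\xi .$$ (1) Let $\alpha,\beta>0$, $L=2\pi/\alpha$, and let $V$ be a measurable function on $(0,L)$ whose values are non-negative Hermitian $M\times M$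 matrices, with $\mathrm{Tr}\,V^{\gamma+1/2}\in L_1(0,L)$. Let $-\lambda_j$ be the negative eigenvalues, counted with multiplicity, of the operator (defined through its quadratic form) $$H_1(\beta)=-\frac{d^2}{dx^2}+\alpha^2\beta-V(x)$$ with periodic boundary conditions in $L_2((0,L);\mathbb C^M)$. Then $$\sum_j\lambda_j^\gamma\le\frac{\pi}{\sqrt3}\,K_1(\beta)\,\mathrm L^{\mathrm{cl}}_{\gamma,1}\int_0^{L}\mathrm{Tr}\bigl[V(x)^{\gamma+1/2}\bigr]\,dx .$$ (2) Let $\delta\in[0,1)$, and let $V$ be a measurable function on $(0,2\pi)$ whose values are non-negative Hermitian $M\times M$ matrices, with $\mathrm{Tr}\,V^{\gamma+1/2}\in L_1(0,2\pi)$. Put $\mathrm P\psi=\psi-\frac1{2\pi}\int_0^{2\pi}\psi(t)\,dt$, componentwise. Let $-\mu_j$ be the negative eigenvalues, counted with multiplicity, of the operator (defined through its quadratic form) $$H_2(\delta)=-\frac{d^2}{dx^2}-\delta-\mathrm P\bigl(V(x)\mathrm P\,\cdot\bigr)$$ with periodic boundary conditions in $\{f\in L_2((0,2\pi);\mathbb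 C^M):\int_0^{2\pi}f\,dx=0\}$. Then $$\sum_j\mu_j^\gamma\le\frac{\pi}{\sqrt3}\,K_2(\delta)\,\mathrm L^{\mathrm{cl}}_{\gamma,1}\int_0^{2\pi}\mathrm{Tr}\bigl[V(x)^{\gamma+1/2}\bigr]\,dx .$$ -/

import Mathlib

open MeasureTheory

open scoped ENNReal ComplexOrder

noncomputable section

/-! ### Periodic Sobolev space on `(0, L)` -/

/-- Lebesgue measure on one period `(0, L)`. -/
abbrev periodMeasure (L : ℝ) : Measure ℝ := volume.restrict (Set.Ioc 0 L)

/-- `u` belongs to `H¹(0, L)_per` and `u'` is its weak derivative: both are square integrable on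
`(0, L)` and integration by parts holds against every smooth `L`-periodic test function. -/
def HasPeriodicWeakDeriv {F : Type*} [NormedAddCommGroup F] [NormedSpace ℝ F]
    (L : ℝ) (u u' : ℝ → F) : Prop :=
  MemLp u 2 (periodMeasure L) ∧ MemLp u' 2 (periodMeasure L) ∧
    ∀ ψ : ℝ → ℝ, ContDiff ℝ ((⊤ : ℕ∞) : WithTop ℕ∞) ψ → Function.Periodic ψ L →
      ∫ x, deriv ψ x • u x ∂(periodMeasure L) = -∫ x, ψ x • u' x ∂(periodMeasure L)

/-! ### The sharp constants of the two interpolation inequalities -/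

/-- The constants `K ≥ 0` for which
`‖u‖_∞² ≤ K (∫ (u'² + α² β u²))^{1/2} (∫ u²)^{1/2}` for all `u ∈ H¹(0, 2π/α)_per`. -/
def firstAdmissible (α β : ℝ) : Set ℝ :=
  {K | 0 ≤ K ∧ ∀ u u' : ℝ → ℝ, HasPeriodicWeakDeriv (2 * Real.pi / α) u u' →
    eLpNorm u ⊤ (periodMeasure (2 * Real.pi / α)) ^ 2 ≤ ENNReal.ofReal
      (K * √(∫ x, (u' x ^ 2 + α ^ 2 * β * u x ^ 2) ∂(periodMeasure (2 * Real.pi / α)))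
        * √(∫ x, u x ^ 2 ∂(periodMeasure (2 * Real.pi / α))))}

/-- The constants `K ≥ 0` for which
`‖u‖_∞² ≤ K (∫ (u'² - β u²))^{1/2} (∫ u²)^{1/2}` for all `u ∈ H¹(0, 2π)_per` of mean zero. -/
def secondAdmissible (β : ℝ) : Set ℝ :=
  {K | 0 ≤ K ∧ ∀ u u' : ℝ → ℝ, HasPeriodicWeakDeriv (2 * Real.pi) u u' →
    ∫ x, u x ∂(periodMeasure (2 * Real.pi)) = 0 →
    eLpNorm u ⊤ (periodMeasure (2 * Real.pi)) ^ 2 ≤ ENNReal.ofReal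
      (K * √(∫ x, (u' x ^ 2 - β * u x ^ 2) ∂(periodMeasure (2 * Real.pi)))
        * √(∫ x, u x ^ 2 ∂(periodMeasure (2 * Real.pi))))}

/-- The sharp constant `K₁(β)`, written for period `2π`; by `K1_eq` every period `2π/α` gives
the same number. -/
def K1 (β : ℝ) : ℝ := sInf (firstAdmissible 1 β)

/-- The sharp constant `K₂(β)`. -/
def K2 (β : ℝ) : ℝ := sInf (secondAdmissible β)

theorem map_mul_periodMeasure {r L : ℝ} (hr : 0 < r) :
    Measure.map (r * ·) (periodMeasure L) = ENNReal.ofReal r⁻¹ • periodMeasure (r * L) := by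
  have he : MeasurableEmbedding (fun x : ℝ => r * x) := measurableEmbedding_mulLeft₀ hr.ne'
  have hpre : (fun x : ℝ => r * x) ⁻¹' Set.Ioc 0 (r * L) = Set.Ioc 0 L := by
    ext x
    simp only [Set.mem_preimage, Set.mem_Ioc, mul_pos_iff_of_pos_left hr, mul_le_mul_iff_right₀ hr]
  have h := he.restrict_map volume (Set.Ioc 0 (r * L))
  rw [hpre, Real.map_volume_mul_left hr.ne', Measure.restrict_smul,
    abs_of_pos (inv_pos.mpr hr)] at h
  exact h.symm

theorem integral_comp_mul_periodMeasure {r L : ℝ} (hr : 0 < r) (f : ℝ → ℝ) :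
    ∫ x, f (r * x) ∂(periodMeasure L) = r⁻¹ * ∫ y, f y ∂(periodMeasure (r * L)) := by
  have he : MeasurableEmbedding (fun x : ℝ => r * x) := measurableEmbedding_mulLeft₀ hr.ne'
  rw [← he.integral_map, map_mul_periodMeasure hr, integral_smul_measure,
    ENNReal.toReal_ofReal (inv_pos.mpr hr).le, smul_eq_mul]

theorem memLp_comp_mul_periodMeasure {r L : ℝ} (hr : 0 < r) {f : ℝ → ℝ}
    (hf : MemLp f 2 (periodMeasure (r * L))) :
    MemLp (fun x => f (r * x)) 2 (periodMeasure L) := by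
  have he : MeasurableEmbedding (fun x : ℝ => r * x) := measurableEmbedding_mulLeft₀ hr.ne'
  have h : MemLp f 2 (Measure.map (r * ·) (periodMeasure L)) := by
    rw [map_mul_periodMeasure hr]
    exact hf.smul_measure ENNReal.ofReal_ne_top
  exact h.comp_of_map he.measurable.aemeasurable

theorem HasPeriodicWeakDeriv.comp_mul {r L : ℝ} (hr : 0 < r) {u u' : ℝ → ℝ}
    (h : HasPeriodicWeakDeriv (r * L) u u') :
    HasPeriodicWeakDeriv L (fun x => u (r * x)) (fun x => r * u' (r * x)) := by
  refine ⟨memLp_comp_mul_periodMeasure hr h.1,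
    (memLp_comp_mul_periodMeasure hr h.2.1).const_mul r, fun ψ hψ hp => ?_⟩
  have hχ : ContDiff ℝ ((⊤ : ℕ∞) : WithTop ℕ∞) (fun y => ψ (r⁻¹ * y)) :=
    hψ.comp (contDiff_const.mul contDiff_id)
  have hχp : Function.Periodic (fun y => ψ (r⁻¹ * y)) (r * L) := fun y => by
    have : r⁻¹ * (y + r * L) = r⁻¹ * y + L := by field_simp
    simp only [this, hp _]
  have key := h.2.2 _ hχ hχp
  have hd : ∀ y, deriv (fun y => ψ (r⁻¹ * y)) y = r⁻¹ * deriv ψ (r⁻¹ * y) := fun y => by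
    rw [deriv_comp_mul_left, smul_eq_mul]
  have e1 := integral_comp_mul_periodMeasure (L := L) hr
    (fun y => deriv (fun y => ψ (r⁻¹ * y)) y • u y)
  have e2 := integral_comp_mul_periodMeasure (L := L) hr (fun y => ψ (r⁻¹ * y) • u' y)
  have hc : ∀ x : ℝ, r⁻¹ * (r * x) = x := fun x => by field_simp
  simp only [hd, hc, smul_eq_mul, mul_assoc] at e1 e2 key ⊢
  rw [integral_const_mul] at e1
  have e3 : ∀ x, ψ x * (r * u' (r * x)) = r * (ψ x * u' (r * x)) := fun x => by ring
  simp only [e3]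
  rw [integral_const_mul, e2]
  rw [key] at e1
  have e4 := mul_left_cancel₀ (inv_pos.mpr hr).ne' e1
  rw [e4, ← mul_assoc, mul_inv_cancel₀ hr.ne', one_mul]

theorem firstAdmissible_subset {a b : ℝ} (ha : 0 < a) (hb : 0 < b) (β : ℝ) :
    firstAdmissible a β ⊆ firstAdmissible b β := by
  rintro K ⟨hK, h⟩
  refine ⟨hK, fun u u' hu => ?_⟩
  have hr : 0 < a / b := div_pos ha hb
  have hL : a / b * (2 * Real.pi / a) = 2 * Real.pi / b := by field_simp
  rw [← hL] at hu ⊢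
  have h1 := h _ _ (hu.comp_mul hr)
  have he : MeasurableEmbedding (fun x : ℝ => a / b * x) := measurableEmbedding_mulLeft₀ hr.ne'
  have hn : eLpNorm (fun x => u (a / b * x)) ⊤ (periodMeasure (2 * Real.pi / a))
      = eLpNorm u ⊤ (periodMeasure (a / b * (2 * Real.pi / a))) := by
    have hm : AEStronglyMeasurable u
        (Measure.map (fun x : ℝ => a / b * x) (periodMeasure (2 * Real.pi / a))) := by
      rw [map_mul_periodMeasure hr]
      exact hu.1.1.smul_measure _
    have := eLpNorm_map_measure (p := ⊤) hm he.measurable.aemeasurable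
    rw [map_mul_periodMeasure hr, eLpNorm_smul_measure_of_ne_zero 
      (ENNReal.ofReal_pos.mpr (inv_pos.mpr hr)).ne'] at this
    simpa [Function.comp_def] using this.symm
  have i1 := integral_comp_mul_periodMeasure (L := 2 * Real.pi / a) hr (fun y => u y ^ 2)
  have i2 := integral_comp_mul_periodMeasure (L := 2 * Real.pi / a) hr
    (fun y => (a / b) ^ 2 * (u' y ^ 2 + b ^ 2 * β * u y ^ 2))
  have i3 : ∀ x, (a / b * u' (a / b * x)) ^ 2 + a ^ 2 * β * u (a / b * x) ^ 2
      = (a / b) ^ 2 * (u' (a / b * x) ^ 2 + b ^ 2 * β * u (a / b * x) ^ 2) := fun x => by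
    field_simp
  rw [integral_const_mul ((a / b) ^ 2) (fun y => u' y ^ 2 + b ^ 2 * β * u y ^ 2)] at i2
  simp only [i3, i1, hn] at h1
  rw [i2] at h1
  refine h1.trans_eq ?_
  have hr' : (a / b)⁻¹ * (a / b) ^ 2 = a / b := by field_simp
  rw [← mul_assoc, hr', mul_assoc, mul_assoc, Real.sqrt_mul hr.le,
    Real.sqrt_mul (inv_pos.mpr hr).le, mul_mul_mul_comm, ← Real.sqrt_mul hr.le,
    mul_inv_cancel₀ hr.ne', Real.sqrt_one, one_mul]

/-- The sharp constant of the first inequality does not depend on the period. -/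
theorem K1_eq {α : ℝ} (hα : 0 < α) (β : ℝ) : sInf (firstAdmissible α β) = K1 β := by
  rw [K1, (firstAdmissible_subset hα one_pos β).antisymm (firstAdmissible_subset one_pos hα β)]

/-! ### The matrix Schrödinger operators -/

/-- The Hilbert space `L₂((0, L); ℂ^M)`. -/
abbrev VecL2 (L : ℝ) (M : ℕ) : Type := Lp (EuclideanSpace ℂ (Fin M)) 2 (periodMeasure L)

/-- The density `⟨V u, w⟩` of the potential energy. -/
def potentialDensity {M : ℕ} (V : ℝ → Matrix (Fin M) (Fin M) ℂ)
    (w u : ℝ → EuclideanSpace ℂ (Fin M)) (x : ℝ) : ℂ :=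
  star (w x).ofLp ⬝ᵥ Matrix.mulVec (V x) (u x).ofLp

theorem potentialDensity_congr {M : ℕ} {μ : Measure ℝ} (V : ℝ → Matrix (Fin M) (Fin M) ℂ)
    (w : ℝ → EuclideanSpace ℂ (Fin M)) {u v : ℝ → EuclideanSpace ℂ (Fin M)} (h : u =ᵐ[μ] v) :
    potentialDensity V w u =ᵐ[μ] potentialDensity V w v := by
  filter_upwards [h] with x hx
  simp only [potentialDensity, hx]

theorem potentialDensity_add {M : ℕ} {L : ℝ} (V : ℝ → Matrix (Fin M) (Fin M) ℂ)
    (w : ℝ → EuclideanSpace ℂ (Fin M)) (u v : VecL2 L M) :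
    potentialDensity V w (u + v : VecL2 L M) =ᵐ[periodMeasure L]
      potentialDensity V w u + potentialDensity V w v := by
  refine (potentialDensity_congr V w (Lp.coeFn_add u v)).trans (ae_of_all _ fun x => ?_)
  simp [potentialDensity, Matrix.mulVec_add, dotProduct_add]

theorem potentialDensity_smul {M : ℕ} {L : ℝ} (V : ℝ → Matrix (Fin M) (Fin M) ℂ)
    (w : ℝ → EuclideanSpace ℂ (Fin M)) (a : ℂ) (u : VecL2 L M) :
    potentialDensity V w (a • u : VecL2 L M) =ᵐ[periodMeasure L]
      a • potentialDensity V w u := by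
  refine (potentialDensity_congr V w (Lp.coeFn_smul a u)).trans (ae_of_all _ fun x => ?_)
  simp [potentialDensity, Matrix.mulVec_smul, dotProduct_smul]

theorem integrable_smul_of_periodic {F : Type*} [NormedAddCommGroup F] [NormedSpace ℝ F]
    {L : ℝ} {g : ℝ → ℝ} (hg : Continuous g) {u : ℝ → F} (hu : MemLp u 2 (periodMeasure L)) :
    Integrable (fun x => g x • u x) (periodMeasure L) := by
  have hu1 : Integrable u (periodMeasure L) := hu.integrable (by norm_num)
  obtain ⟨C, hC⟩ := (isCompact_Icc (a := (0 : ℝ)) (b := L)).exists_bound_of_continuousOn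
    hg.continuousOn
  refine hu1.bdd_smul C hg.aestronglyMeasurable ?_
  exact (ae_restrict_mem measurableSet_Ioc).mono fun x hx => hC x (Set.Ioc_subset_Icc_self hx)

theorem HasPeriodicWeakDeriv.add_Lp {L : ℝ} {M : ℕ} {u u' v v' : VecL2 L M}
    (hu : HasPeriodicWeakDeriv L u u') (hv : HasPeriodicWeakDeriv L v v') :
    HasPeriodicWeakDeriv L (u + v : VecL2 L M) (u' + v' : VecL2 L M) := by
  refine ⟨Lp.memLp _, Lp.memLp _, fun ψ hψ hp => ?_⟩
  have hd : Continuous (deriv ψ) := hψ.continuous_deriv (by simp)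
  have e1 : ∫ x, deriv ψ x • (u + v : VecL2 L M) x ∂(periodMeasure L)
      = ∫ x, (deriv ψ x • u x + deriv ψ x • v x) ∂(periodMeasure L) :=
    integral_congr_ae ((Lp.coeFn_add u v).mono fun x hx => by
      simp only [hx, Pi.add_apply, smul_add])
  have e2 : ∫ x, ψ x • (u' + v' : VecL2 L M) x ∂(periodMeasure L)
      = ∫ x, (ψ x • u' x + ψ x • v' x) ∂(periodMeasure L) :=
    integral_congr_ae ((Lp.coeFn_add u' v').mono fun x hx => by
      simp only [hx, Pi.add_apply, smul_add])
  rw [e1, e2, integral_add (integrable_smul_of_periodic hd hu.1)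
    (integrable_smul_of_periodic hd hv.1), integral_add
    (integrable_smul_of_periodic hψ.continuous hu.2.1)
    (integrable_smul_of_periodic hψ.continuous hv.2.1), hu.2.2 ψ hψ hp, hv.2.2 ψ hψ hp, neg_add]

theorem HasPeriodicWeakDeriv.smul_Lp {L : ℝ} {M : ℕ} (a : ℂ) {u u' : VecL2 L M}
    (hu : HasPeriodicWeakDeriv L u u') :
    HasPeriodicWeakDeriv L (a • u : VecL2 L M) (a • u' : VecL2 L M) := by
  refine ⟨Lp.memLp _, Lp.memLp _, fun ψ hψ hp => ?_⟩
  have e1 : ∫ x, deriv ψ x • (a • u : VecL2 L M) x ∂(periodMeasure L)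
      = ∫ x, a • (deriv ψ x • u x) ∂(periodMeasure L) :=
    integral_congr_ae ((Lp.coeFn_smul a u).mono fun x hx => by
      simp only [hx, Pi.smul_apply]; exact smul_comm _ _ _)
  have e2 : ∫ x, ψ x • (a • u' : VecL2 L M) x ∂(periodMeasure L)
      = ∫ x, a • (ψ x • u' x) ∂(periodMeasure L) :=
    integral_congr_ae ((Lp.coeFn_smul a u').mono fun x hx => by
      simp only [hx, Pi.smul_apply]; exact smul_comm _ _ _)
  rw [e1, e2, integral_smul, integral_smul, hu.2.2 ψ hψ hp, smul_neg]

/-- The graph of the self-adjoint operator `-d²/dx² + c - T* V T` with periodic boundary conditions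
in the Hilbert space `S ⊆ L₂((0, L); ℂ^M)`, defined through its quadratic form: `u` is in the domain
and `f` is its image if and only if `u` lies in the form domain `H¹_per ∩ S`, `f ∈ S`, and
`(u', w') + c (u, w) - ∫ ⟨V T u, T w⟩ = (f, w)` for all `w` in the form domain. -/
def schrodingerGraph {M : ℕ} (L c : ℝ) (V : ℝ → Matrix (Fin M) (Fin M) ℂ)
    (S : Submodule ℂ (VecL2 L M)) (T : VecL2 L M →ₗ[ℂ] VecL2 L M) :
    Submodule ℂ (VecL2 L M × VecL2 L M) where
  carrier := {p | p.1 ∈ S ∧ p.2 ∈ S ∧ ∃ u' : VecL2 L M, HasPeriodicWeakDeriv L p.1 u' ∧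
    ∀ w w' : VecL2 L M, w ∈ S → HasPeriodicWeakDeriv L w w' →
      Integrable (potentialDensity V (T w) (T p.1)) (periodMeasure L) ∧
      inner ℂ w' u' + (c : ℂ) * inner ℂ w p.1
        - ∫ x, potentialDensity V (T w) (T p.1) x ∂(periodMeasure L) = inner ℂ w p.2}
  zero_mem' := by
    have h0 : HasPeriodicWeakDeriv L (0 : VecL2 L M) (0 : VecL2 L M) := by
      refine ⟨Lp.memLp _, Lp.memLp _, fun ψ _ _ => ?_⟩
      have e : ∀ g : ℝ → ℝ, ∫ x, g x • (0 : VecL2 L M) x ∂(periodMeasure L) = 0 := fun g =>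
        integral_eq_zero_of_ae ((Lp.coeFn_zero (EuclideanSpace ℂ (Fin M)) 2
          (periodMeasure L)).mono fun x hx => by simp only [hx, Pi.zero_apply, smul_zero])
      rw [e, e, neg_zero]
    refine ⟨S.zero_mem, S.zero_mem, 0, h0, fun w w' _ _ => ?_⟩
    have h : potentialDensity V (T w) (T (0 : VecL2 L M)) =ᵐ[periodMeasure L] 0 := by
      rw [← zero_smul ℂ (0 : VecL2 L M), map_smul]
      exact (potentialDensity_smul V _ 0 _).trans (by simp)
    refine ⟨(integrable_zero _ _ _).congr h.symm, ?_⟩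
    have h' : ∫ x, potentialDensity V (T w) (T (0 : VecL2 L M)) x ∂(periodMeasure L) = 0 := by
      rw [integral_congr_ae h]
      simp
    simp only [Prod.fst_zero, Prod.snd_zero, inner_zero_right, h']
    simp
  add_mem' := by
    rintro ⟨u, f⟩ ⟨v, g⟩ ⟨hu, hf, u', hu', H⟩ ⟨hv, hg, v', hv', G⟩
    refine ⟨S.add_mem hu hv, S.add_mem hf hg, u' + v', hu'.add_Lp hv', fun w w' hw hw' => ?_⟩
    obtain ⟨H1, H2⟩ := H w w' hw hw'
    obtain ⟨G1, G2⟩ := G w w' hw hw'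
    have h := potentialDensity_add V (T w) (T u) (T v)
    rw [← map_add] at h
    refine ⟨(H1.add G1).congr h.symm, ?_⟩
    simp only [Prod.mk_add_mk] at H1 H2 G1 G2 ⊢
    rw [integral_congr_ae h, integral_add' H1 G1]
    simp only [inner_add_right]
    rw [← H2, ← G2]
    ring
  smul_mem' := by
    rintro a ⟨u, f⟩ ⟨hu, hf, u', hu', H⟩
    refine ⟨S.smul_mem a hu, S.smul_mem a hf, a • u', hu'.smul_Lp a, fun w w' hw hw' => ?_⟩
    obtain ⟨H1, H2⟩ := H w w' hw hw'
    have h := potentialDensity_smul V (T w) a (T u)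
    rw [← map_smul] at h
    refine ⟨(H1.smul a).congr h.symm, ?_⟩
    simp only [Prod.smul_mk] at H1 H2 ⊢
    rw [integral_congr_ae h]
    simp only [Pi.smul_apply, inner_smul_right]
    rw [integral_smul, smul_eq_mul]
    rw [← H2]
    ring

/-- The mean value `(1/L) ∫_0^L u`, taken componentwise. -/
def meanValue (L : ℝ) (M : ℕ) : VecL2 L M →ₗ[ℂ] EuclideanSpace ℂ (Fin M) where
  toFun u := ((1 / L : ℝ) : ℂ) • ∫ x, u x ∂(periodMeasure L)
  map_add' u v := by
    rw [integral_congr_ae (Lp.coeFn_add u v), integral_add'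
      ((Lp.memLp u).integrable (by norm_num)) ((Lp.memLp v).integrable (by norm_num)), smul_add]
  map_smul' a u := by
    rw [integral_congr_ae (Lp.coeFn_smul a u)]
    simp only [Pi.smul_apply, integral_smul, RingHom.id_apply]
    rw [smul_comm]

/-- The orthogonal projection `P u = u - (1/L) ∫_0^L u`. -/
def meanZeroProj (L : ℝ) (M : ℕ) : VecL2 L M →ₗ[ℂ] VecL2 L M :=
  LinearMap.id - Lp.constₗ 2 (periodMeasure L) ℂ ∘ₗ meanValue L M

/-- The space of square integrable vector functions with mean value zero. -/
def meanZeroSpace (L : ℝ) (M : ℕ) : Submodule ℂ (VecL2 L M) := LinearMap.ker (meanValue L M)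

/-- `H₁(β) = -d²/dx² + α² β - V` in `L₂((0, 2π/α); ℂ^M)`, as a graph. -/
def H1 {M : ℕ} (α β : ℝ) (V : ℝ → Matrix (Fin M) (Fin M) ℂ) :
    Submodule ℂ (VecL2 (2 * Real.pi / α) M × VecL2 (2 * Real.pi / α) M) :=
  schrodingerGraph (2 * Real.pi / α) (α ^ 2 * β) V ⊤ LinearMap.id

/-- `H₂(δ) = -d²/dx² - δ - P (V P ·)` in the mean-zero subspace of `L₂((0, 2π); ℂ^M)`,
as a graph. -/
def H2 {M : ℕ} (δ : ℝ) (V : ℝ → Matrix (Fin M) (Fin M) ℂ) :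
    Submodule ℂ (VecL2 (2 * Real.pi) M × VecL2 (2 * Real.pi) M) :=
  schrodingerGraph (2 * Real.pi) (-δ) V (meanZeroSpace (2 * Real.pi) M)
    (meanZeroProj (2 * Real.pi) M)

/-! ### Riesz means of the negative eigenvalues -/

/-- The eigenspace `{u | A u = E u}` of the operator with graph `A`. -/
def graphEigenspace {H : Type*} [AddCommGroup H] [Module ℂ H] (A : Submodule ℂ (H × H)) (E : ℝ) :
    Submodule ℂ H :=
  A.comap (LinearMap.prod LinearMap.id ((E : ℂ) • LinearMap.id))

/-- `∑_j λ_j^γ` over the negative eigenvalues `-λ_j` of the operator with graph `A`, each repeated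
according to its multiplicity, as an element of `[0, ∞]`. -/
def rieszMean {H : Type*} [AddCommGroup H] [Module ℂ H] (γ : ℝ) (A : Submodule ℂ (H × H)) : ℝ≥0∞ :=
  ∑' E : Set.Iio (0 : ℝ),
    ((Cardinal.toENat (Module.rank ℂ (graphEigenspace A E)) : ℕ∞) : ℝ≥0∞)
      * ENNReal.ofReal ((-(E : ℝ)) ^ γ)

/-- The semiclassical constant in dimension one, `(2π)⁻¹ ∫ (1 - ξ²)_+^γ dξ`. -/
def semiclassicalConst (γ : ℝ) : ℝ := (2 * Real.pi)⁻¹ * ∫ ξ : ℝ, (max (1 - ξ ^ 2) 0) ^ γ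

/-- `Tr A^s` for a positive semidefinite matrix `A`, with `A^s` given by the functional calculus. -/
def tracePow {M : ℕ} (A : Matrix (Fin M) (Fin M) ℂ) (s : ℝ) : ℝ :=
  (Matrix.trace (cfc (fun t : ℝ => t ^ s) A)).re

end

/-! The argument is the Eden–Foias duality method for matrix potentials, combined with Aizenman–Lieb
lifting in `γ`. Let `K` be any admissible constant and `φ_j` a finite orthonormal family of
eigenfunctions with eigenvalues `-l_j < 0`. The scalar inequality, applied to the real functions `Re
⟨e, ∑ ξ_j φ_j⟩`, holds for almost every `x` simultaneously for all `e` and `ξ`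
(`ae_forall_interpolation`).

At such an `x`, take `e = b_m`, a unit eigenvector of `V(x)`, and `ξ_j = ⟨φ_j(x), b_m⟩` on a chosen
subfamily, zero elsewhere. With `ν = ∑ |⟨b_m, φ_j(x)⟩|²` over the subfamily and `Q` the energy form
at `ξ`, this reads `ν² ≤ K √Q √ν`, that is `ν³ ≤ K² Q`. Maximising `w ν - ν³ / K²` over `ν ≥ 0`
gives `w ν - Q ≤ 2K/(3√3) w_+^{3/2}`. With `w` an eigenvalue of `V(x) - t`, summing over `m` yields
`trace_sub_energy_le`, whose right side is a multiple of `Tr (V(x) - t)_+^{3/2}`.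

For the lifting, write `s_+^γ = ∫ (s - t)_+ dτ(t)` with a positive measure `τ`. At level `t` the
subfamily consists of the `j` with `l_j > t`. Integrating over `t` and then over `x` turns the left
side into `∑ l_j^γ`: orthonormality removes the off-diagonal energies, and the weak eigenvalue
equation tested on `φ_j` gives the diagonal ones. The right side becomes the semiclassical integral
by Fubini and `∫ (r - ξ²)_+ dξ = (4/3) r_+^{3/2}`. This is `sum_rpow_le_of_eigenfamily`.

A bound uniform over finite families controls the full Riesz mean, and letting `K` tend to the
infimum gives the sharp constants. The infimum is meaningful only if some constant is admissible;
Fourier series and a Carlson inequality supply one. -/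

theorem HasPeriodicWeakDeriv.clm_comp {F G : Type*} [NormedAddCommGroup F] [NormedSpace ℝ F]
    [CompleteSpace F] [NormedAddCommGroup G] [NormedSpace ℝ G] [CompleteSpace G] {L : ℝ}
    {u u' : ℝ → F} (T : F →L[ℝ] G) (hu : HasPeriodicWeakDeriv L u u') :
    HasPeriodicWeakDeriv L (fun x => T (u x)) (fun x => T (u' x)) := by
  refine ⟨T.comp_memLp' hu.1, T.comp_memLp' hu.2.1, fun ψ hψ hp => ?_⟩
  have hd : Continuous (deriv ψ) := hψ.continuous_deriv (by simp)
  simp only [← map_smul]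
  rw [T.integral_comp_comm (integrable_smul_of_periodic hd hu.1),
    T.integral_comp_comm (integrable_smul_of_periodic hψ.continuous hu.2.1), hu.2.2 ψ hψ hp,
    map_neg]

/-! ### Fourier coefficients on `(0, 2π)` -/

local instance : Fact (0 < 2 * Real.pi) := ⟨Real.two_pi_pos⟩

/-- The Fourier coefficients of a function on `(0, 2π)`. -/
noncomputable def circleCoeff (f : ℝ → ℂ) (k : ℤ) : ℂ :=
  fourierCoeff (AddCircle.liftIoc (2 * Real.pi) 0 f) k

theorem circleCoeff_eq (f : ℝ → ℂ) (k : ℤ) :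
    circleCoeff f k = (2 * Real.pi)⁻¹ • ∫ x, Complex.exp (-(k * x * Complex.I)) * f x
      ∂(periodMeasure (2 * Real.pi)) := by
  rw [circleCoeff, fourierCoeff_eq_intervalIntegral _ _ 0, zero_add, one_div,
    intervalIntegral.integral_of_le Real.two_pi_pos.le]
  congr 1
  refine setIntegral_congr_fun measurableSet_Ioc fun x hx => ?_
  rw [AddCircle.liftIoc_coe_apply (by simpa using hx), fourier_coe_apply, smul_eq_mul]
  congr 2
  have : (Real.pi : ℂ) ≠ 0 := by exact_mod_cast Real.pi_ne_zero
  push_cast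
  field_simp

theorem hasSum_sq_circleCoeff {f : ℝ → ℂ} (hf : MemLp f 2 (periodMeasure (2 * Real.pi))) :
    HasSum (fun k => ‖circleCoeff f k‖ ^ 2)
      ((2 * Real.pi)⁻¹ * ∫ x, ‖f x‖ ^ 2 ∂(periodMeasure (2 * Real.pi))) := by
  have h := hasSum_sq_fourierCoeffOn Real.two_pi_pos hf
  rw [sub_zero, intervalIntegral.integral_of_le Real.two_pi_pos.le, smul_eq_mul] at h
  convert h using 3 with k
  rw [circleCoeff_eq, fourierCoeffOn_eq_integral, sub_zero, one_div,
    intervalIntegral.integral_of_le Real.two_pi_pos.le]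
  congr 2
  refine setIntegral_congr_fun measurableSet_Ioc fun x hx => ?_
  rw [fourier_coe_apply, smul_eq_mul]
  congr 2
  have : (Real.pi : ℂ) ≠ 0 := by exact_mod_cast Real.pi_ne_zero
  push_cast
  field_simp

/-- The functions `sin (k x)` and `cos (k x)` are admissible real periodic test functions; together
they give the exponential. -/
theorem HasPeriodicWeakDeriv.circleCoeff_deriv {f f' : ℝ → ℂ}
    (hf : HasPeriodicWeakDeriv (2 * Real.pi) f f') (k : ℤ) :
    circleCoeff f' k = Complex.I * k * circleCoeff f k := by
  have hs := hf.2.2 (fun x => Real.sin (k * x)) (by fun_prop) (fun x => by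
    simp only [mul_add]
    rw [Real.sin_add_int_mul_two_pi])
  have hc := hf.2.2 (fun x => Real.cos (k * x)) (by fun_prop) (fun x => by
    simp only [mul_add]
    rw [Real.cos_add_int_mul_two_pi])
  have ds : deriv (fun x : ℝ => Real.sin (k * x)) = fun x => k * Real.cos (k * x) := by
    ext x
    simp [mul_comm]
  have dc : deriv (fun x : ℝ => Real.cos (k * x)) = fun x => -(k * Real.sin (k * x)) := by
    ext x
    simp [mul_comm]
  have key : ∀ g : ℝ → ℂ, MemLp g 2 (periodMeasure (2 * Real.pi)) →
      ∫ x, Complex.exp (-(k * x * Complex.I)) * g x ∂(periodMeasure (2 * Real.pi))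
      = ∫ x, Real.cos (k * x) • g x ∂(periodMeasure (2 * Real.pi))
        - Complex.I * ∫ x, Real.sin (k * x) • g x ∂(periodMeasure (2 * Real.pi)) := by
    intro g hg
    rw [← integral_const_mul, ← integral_sub (integrable_smul_of_periodic (by fun_prop) hg)
      ((integrable_smul_of_periodic (by fun_prop) hg).const_mul _)]
    congr 1
    ext x
    rw [show -((k : ℂ) * x * Complex.I) = (-(k * x) : ℂ) * Complex.I by ring,
      Complex.exp_mul_I, Complex.cos_neg, Complex.sin_neg]
    simp only [Complex.real_smul]
    push_cast
    ring
  rw [circleCoeff_eq, circleCoeff_eq, key f hf.1, key f' hf.2.1]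
  rw [ds] at hs
  rw [dc] at hc
  simp only [mul_smul, neg_smul, integral_neg, integral_smul, neg_inj] at hs hc
  have hs' : ∫ x, Real.sin (k * x) • f' x ∂(periodMeasure (2 * Real.pi))
      = -((k : ℝ) • ∫ x, Real.cos (k * x) • f x ∂(periodMeasure (2 * Real.pi))) := by
    rw [hs, neg_neg]
  rw [← hc, hs']
  generalize ∫ x, Real.sin (k * x) • f x ∂(periodMeasure (2 * Real.pi)) = S
  generalize ∫ x, Real.cos (k * x) • f x ∂(periodMeasure (2 * Real.pi)) = C
  simp only [Complex.real_smul]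
  push_cast
  linear_combination ((2 * Real.pi : ℂ)⁻¹ * k * S) * Complex.I_sq

theorem circleCoeff_zero (f : ℝ → ℂ) :
    circleCoeff f 0 = (2 * Real.pi)⁻¹ • ∫ x, f x ∂(periodMeasure (2 * Real.pi)) := by
  simp [circleCoeff_eq]

theorem HasPeriodicWeakDeriv.hasSum_sq_deriv {f f' : ℝ → ℂ}
    (hf : HasPeriodicWeakDeriv (2 * Real.pi) f f') :
    HasSum (fun k : ℤ => (k : ℝ) ^ 2 * ‖circleCoeff f k‖ ^ 2)
      ((2 * Real.pi)⁻¹ * ∫ x, ‖f' x‖ ^ 2 ∂(periodMeasure (2 * Real.pi))) := by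
  convert hasSum_sq_circleCoeff hf.2.1 using 2 with k
  rw [hf.circleCoeff_deriv, norm_mul, norm_mul, Complex.norm_I, one_mul, mul_pow,
    Complex.norm_intCast, sq_abs]

/-- The Poincaré–Wirtinger inequality on the circle. -/
theorem HasPeriodicWeakDeriv.poincare {f f' : ℝ → ℂ}
    (hf : HasPeriodicWeakDeriv (2 * Real.pi) f f')
    (h0 : ∫ x, f x ∂(periodMeasure (2 * Real.pi)) = 0) :
    ∫ x, ‖f x‖ ^ 2 ∂(periodMeasure (2 * Real.pi))
      ≤ ∫ x, ‖f' x‖ ^ 2 ∂(periodMeasure (2 * Real.pi)) := by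
  have hp : 0 < (2 * Real.pi)⁻¹ := inv_pos.mpr Real.two_pi_pos
  refine le_of_mul_le_mul_left ?_ hp
  refine hasSum_le (fun k => ?_) (hasSum_sq_circleCoeff hf.1) hf.hasSum_sq_deriv
  rcases eq_or_ne k 0 with rfl | hk
  · simp [circleCoeff_zero, h0]
  · have : (1 : ℝ) ≤ (k : ℝ) ^ 2 := by
      exact_mod_cast Int.add_one_le_iff.mpr (by positivity : 0 < k ^ 2)
    nlinarith [sq_nonneg ‖circleCoeff f k‖]

/-- Absolute summability makes the Fourier series converge uniformly to a continuous `g`. Its `L²`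
limit is also `f`, so `f = g` almost everywhere, and `g` obeys the bound everywhere. -/
theorem ae_norm_le_tsum_circleCoeff {f : ℝ → ℂ} (hf : MemLp f 2 (periodMeasure (2 * Real.pi)))
    (hs : Summable fun k => ‖circleCoeff f k‖) :
    ∀ᵐ x ∂(periodMeasure (2 * Real.pi)), ‖f x‖ ≤ ∑' k, ‖circleCoeff f k‖ := by
  have hf0 : MemLp f 2 (volume.restrict (Set.Ioc 0 (0 + 2 * Real.pi))) := by simpa using hf
  have hF := hf0.memLp_liftIoc.haarAddCircle
  have h2 := hasSum_fourier_series_L2 hF.toLp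
  have hs' : Summable fun k : ℤ => circleCoeff f k • (fourier k : C(AddCircle (2 * Real.pi), ℂ)) := by
    refine .of_norm ?_
    simpa only [norm_smul, fourier_norm, mul_one] using hs
  have hc : fourierCoeff (hF.toLp : AddCircle (2 * Real.pi) → ℂ) = circleCoeff f := by
    ext k
    rw [circleCoeff, fourierCoeff_congr_ae hF.coeFn_toLp]
  rw [hc] at h2
  obtain ⟨g, hg⟩ := hs'
  have hg2 := (ContinuousMap.toLp (E := ℂ) 2 (@AddCircle.haarAddCircle (2 * Real.pi) _) ℂ).hasSum hg
  have e : ContinuousMap.toLp (E := ℂ) 2 (@AddCircle.haarAddCircle (2 * Real.pi) _) ℂ g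
      = hF.toLp := by
    refine hg2.unique ?_
    simpa only [Function.comp_def, map_smul] using h2
  have hgb : ∀ x, ‖g x‖ ≤ ∑' k, ‖circleCoeff f k‖ := fun x => by
    refine (g.norm_coe_le_norm x).trans ?_
    rw [← hg.tsum_eq]
    refine (norm_tsum_le_tsum_norm ?_).trans_eq ?_ <;>
      simp only [norm_smul, fourier_norm, mul_one, hs]
  have hae : AddCircle.liftIoc (2 * Real.pi) 0 f =ᵐ[AddCircle.haarAddCircle] g := by
    have := ContinuousMap.coeFn_toLp (p := 2) (𝕜 := ℂ) (@AddCircle.haarAddCircle (2 * Real.pi) _) g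
    rw [e] at this
    exact hF.coeFn_toLp.symm.trans this
  have hae' : ∀ᵐ y : AddCircle (2 * Real.pi),
      ‖AddCircle.liftIoc (2 * Real.pi) 0 f y‖ ≤ ∑' k, ‖circleCoeff f k‖ := by
    rw [AddCircle.volume_eq_smul_haarAddCircle]
    refine Measure.ae_smul_measure ?_ _
    filter_upwards [hae] with y hy
    rw [hy]
    exact hgb y
  have := (AddCircle.measurePreserving_mk (2 * Real.pi) 0).quasiMeasurePreserving.ae hae'
  rw [zero_add] at this
  filter_upwards [this, ae_restrict_mem measurableSet_Ioc] with x hx hm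
  rwa [AddCircle.liftIoc_coe_apply (by simpa using hm)] at hx

/-! ### Sup-norm bounds and existence of admissible constants. -/

theorem hasSum_int_inv_sq_add_sq {s : ℝ} (hs : 0 < s) :
    ∃ S, S ≤ 4 / s + 1 / s ^ 2 ∧ HasSum (fun k : ℤ => 1 / ((k : ℝ) ^ 2 + s ^ 2)) S := by
  -- Telescoping: the right side is `2 / ((n + s)(n + 1 + s))`, and `(n + s)(n + 1 + s) ≤ (n + 1 +
  -- s)² ≤ 2((n + 1)² + s²)`.
  have step : ∀ n : ℕ, 1 / (((n : ℝ) + 1) ^ 2 + s ^ 2) ≤ 2 / (n + s) - 2 / (n + 1 + s) := by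
    intro n
    have hn : (0 : ℝ) ≤ n := n.cast_nonneg
    rw [div_sub_div _ _ (by positivity) (by positivity),
      div_le_div_iff₀ (by positivity) (by positivity)]
    nlinarith [sq_nonneg ((n : ℝ) + 1 - s)]
  have hb : ∀ N : ℕ, ∑ n ∈ Finset.range N, 1 / (((n : ℝ) + 1) ^ 2 + s ^ 2) ≤ 2 / s := by
    intro N
    have : ∑ n ∈ Finset.range N, 1 / (((n : ℝ) + 1) ^ 2 + s ^ 2) ≤ 2 / s - 2 / (N + s) := by
      induction N with
      | zero => simp
      | succ N ih =>
        rw [Finset.sum_range_succ]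
        push_cast
        linarith [step N]
    have : 0 ≤ 2 / ((N : ℝ) + s) := by positivity
    linarith
  have hpos : ∀ n : ℕ, 0 ≤ 1 / (((n : ℝ) + 1) ^ 2 + s ^ 2) := fun n => by positivity
  have hS := summable_of_sum_range_le hpos hb
  have hT := Real.tsum_le_of_sum_range_le hpos hb
  -- Split at zero: the positive and the negative integers contribute at most `2 / s` each, and `k =
  -- 0` contributes `1 / s²`.
  have h1 : HasSum (fun n : ℕ => 1 / (((n : ℤ) : ℝ) ^ 2 + s ^ 2))
      (∑' n : ℕ, 1 / (((n : ℝ) + 1) ^ 2 + s ^ 2) + 1 / s ^ 2) := by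
    have := (hasSum_nat_add_iff (f := fun n : ℕ => 1 / (((n : ℤ) : ℝ) ^ 2 + s ^ 2)) 1
      (g := ∑' n : ℕ, 1 / (((n : ℝ) + 1) ^ 2 + s ^ 2))).mp (by simpa using hS.hasSum)
    simpa using this
  have h2 : HasSum (fun n : ℕ => 1 / (((-((n : ℤ) + 1) : ℤ) : ℝ) ^ 2 + s ^ 2))
      (∑' n : ℕ, 1 / (((n : ℝ) + 1) ^ 2 + s ^ 2)) := by
    convert hS.hasSum using 4 with n
    push_cast
    ring
  refine ⟨_, ?_, HasSum.of_nat_of_neg_add_one h1 h2⟩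
  have : 4 / s = 2 / s + 2 / s := by ring
  linarith

/-- A Carlson type inequality. -/
theorem sq_tsum_le_of_hasSum {c : ℤ → ℝ} (hc : ∀ k, 0 ≤ c k) {A B β : ℝ} (hβ : 0 < β)
    (hA : HasSum (fun k : ℤ => (k : ℝ) ^ 2 * c k ^ 2) A) (hB : HasSum (fun k => c k ^ 2) B) :
    Summable c ∧ (∑' k, c k) ^ 2 ≤ (8 + 2 / √β) * √(A + β * B) * √B := by
  have hA0 : 0 ≤ A := hA.nonneg fun k => by positivity
  have hB0 : 0 ≤ B := hB.nonneg fun k => by positivity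
  rcases hB0.eq_or_lt with h0 | hBpos
  · have hz : c = 0 := by
      ext k
      rw [← h0] at hB
      have := (hasSum_zero_iff_of_nonneg (fun k => sq_nonneg (c k))).mp hB
      simpa using congrFun this k
    exact ⟨by rw [hz]; exact summable_zero, by simp [hz, ← h0]⟩
  have hDpos : 0 < A + β * B := by positivity
  -- This weight makes `s² B = A + β B`, so both parts of `∑ (k² + s²) c_k²` are at most `s² B`,
  -- while `s ≥ √β` keeps `1 / s` bounded.
  set s : ℝ := √(A + β * B) / √B with hsdef
  have hs : 0 < s := by positivity
  have hs2 : s ^ 2 * B = A + β * B := by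
    rw [hsdef, div_pow, Real.sq_sqrt hDpos.le, Real.sq_sqrt hB0]
    field_simp
  have hsβ : √β ≤ s := by
    refine Real.sqrt_le_iff.mpr ⟨hs.le, ?_⟩
    have : β * B ≤ s ^ 2 * B := by linarith
    exact le_of_mul_le_mul_right this hBpos
  obtain ⟨S, hS, hSs⟩ := hasSum_int_inv_sq_add_sq hs
  have hW : HasSum (fun k : ℤ => ((k : ℝ) ^ 2 + s ^ 2) * c k ^ 2) (A + s ^ 2 * B) := by
    simpa only [add_mul] using hA.add (hB.mul_left (s ^ 2))
  have hSpos : 0 < S := by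
    refine lt_of_lt_of_le ?_ (le_hasSum hSs 0 fun k _ => by positivity)
    positivity
  -- Weighted AM–GM stands in for Cauchy–Schwarz: `θ = 1` gives summability, and the optimal `θ = X
  -- / S`, with `X = ∑ c_k`, gives the product bound.
  have amgm : ∀ θ : ℝ, 0 < θ → ∀ k : ℤ, 2 * c k ≤
      θ * (1 / ((k : ℝ) ^ 2 + s ^ 2)) + θ⁻¹ * (((k : ℝ) ^ 2 + s ^ 2) * c k ^ 2) := by
    intro θ hθ k
    have hw : 0 < (k : ℝ) ^ 2 + s ^ 2 := by positivity
    generalize (k : ℝ) ^ 2 + s ^ 2 = w at hw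
    have : θ * (1 / w) + θ⁻¹ * (w * c k ^ 2) - 2 * c k = (θ - w * c k) ^ 2 / (θ * w) := by
      field_simp
      ring
    have h2 : 0 ≤ (θ - w * c k) ^ 2 / (θ * w) := by positivity
    linarith
  have hsum : Summable c := by
    have := Summable.of_nonneg_of_le (fun k => by have := hc k; positivity) (amgm 1 one_pos)
      ((hSs.mul_left 1).add (hW.mul_left 1⁻¹)).summable
    exact (summable_mul_left_iff two_ne_zero).mp this
  refine ⟨hsum, ?_⟩
  have hX0 : 0 ≤ ∑' k, c k := tsum_nonneg hc
  have hX : (∑' k, c k) ^ 2 ≤ S * (A + s ^ 2 * B) := by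
    rcases hX0.eq_or_lt with h | h
    · have : 0 ≤ S * (A + s ^ 2 * B) := by positivity
      simpa [← h] using this
    · have h1 := hasSum_le (amgm _ (div_pos h hSpos)) (hsum.hasSum.mul_left 2)
        ((hSs.mul_left _).add (hW.mul_left _))
      generalize ∑' k, c k = X at *
      rw [inv_div, div_mul_cancel₀ _ hSpos.ne'] at h1
      have h2 : X ≤ S / X * (A + s ^ 2 * B) := by linarith
      calc X ^ 2 = X * X := sq X
        _ ≤ X * (S / X * (A + s ^ 2 * B)) := by gcongr
        _ = _ := by field_simp
  have hbd : (4 / s + 1 / s ^ 2) * (A + s ^ 2 * B) ≤ (4 / s + 1 / s ^ 2) * (2 * s ^ 2 * B) := by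
    gcongr
    nlinarith [mul_pos hβ hBpos]
  have he : (4 / s + 1 / s ^ 2) * (2 * s ^ 2 * B) = (8 + 2 / s) * (s * B) := by
    field_simp
    ring
  have hsB : s * B = √(A + β * B) * √B := by
    rw [hsdef]
    have := Real.mul_self_sqrt hB0
    field_simp
    rw [sq, this]
  calc (∑' k, c k) ^ 2 ≤ S * (A + s ^ 2 * B) := hX
    _ ≤ (4 / s + 1 / s ^ 2) * (A + s ^ 2 * B) := by gcongr
    _ ≤ (8 + 2 / s) * (s * B) := hbd.trans_eq he
    _ ≤ (8 + 2 / √β) * (s * B) := by gcongr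
    _ = _ := by rw [hsB]; ring

theorem HasPeriodicWeakDeriv.sup_bound {u u' : ℝ → ℝ}
    (hu : HasPeriodicWeakDeriv (2 * Real.pi) u u') {β : ℝ} (hβ : 0 < β) :
    eLpNorm u ⊤ (periodMeasure (2 * Real.pi)) ^ 2 ≤ ENNReal.ofReal
      ((8 + 2 / √β) * √(∫ x, u' x ^ 2 ∂(periodMeasure (2 * Real.pi))
        + β * ∫ x, u x ^ 2 ∂(periodMeasure (2 * Real.pi)))
        * √(∫ x, u x ^ 2 ∂(periodMeasure (2 * Real.pi)))) := by
  have hf := hu.clm_comp Complex.ofRealCLM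
  simp only [Complex.ofRealCLM_apply] at hf
  obtain ⟨h1, h2⟩ := sq_tsum_le_of_hasSum (fun _ => norm_nonneg _) hβ hf.hasSum_sq_deriv
    (hasSum_sq_circleCoeff hf.1)
  have h3 := ae_norm_le_tsum_circleCoeff hf.1 h1
  simp only [Complex.norm_real, Real.norm_eq_abs, sq_abs] at h2 h3
  set X := ∑' k, ‖circleCoeff (fun x => (u x : ℂ)) k‖
  have hX : 0 ≤ X := tsum_nonneg fun _ => norm_nonneg _
  have h4 : eLpNorm u ⊤ (periodMeasure (2 * Real.pi)) ≤ ENNReal.ofReal X := by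
    rw [eLpNorm_exponent_top]
    refine eLpNormEssSup_le_of_ae_bound h3
  calc _ ≤ ENNReal.ofReal X ^ 2 := by gcongr
    _ = ENNReal.ofReal (X ^ 2) := (ENNReal.ofReal_pow hX 2).symm
    _ ≤ _ := ENNReal.ofReal_le_ofReal ?_
  refine h2.trans ?_
  -- The Parseval factors `1 / (2π)` are simply discarded, since any finite constant will do.
  have hπ : (2 * Real.pi)⁻¹ ≤ 1 := inv_le_one_of_one_le₀ (by linarith [Real.two_le_pi])
  have hπ0 : 0 ≤ (2 * Real.pi)⁻¹ := by positivity
  have hP : 0 ≤ ∫ x, u' x ^ 2 ∂(periodMeasure (2 * Real.pi)) :=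
    integral_nonneg fun _ => sq_nonneg _
  have hQ : 0 ≤ ∫ x, u x ^ 2 ∂(periodMeasure (2 * Real.pi)) :=
    integral_nonneg fun _ => sq_nonneg _
  gcongr
  · exact mul_le_of_le_one_left hP hπ
  · exact mul_le_of_le_one_left hQ hπ
  · exact mul_le_of_le_one_left hQ hπ

theorem firstAdmissible_one_nonempty {β : ℝ} (hβ : 0 < β) : (firstAdmissible 1 β).Nonempty := by
  refine ⟨8 + 2 / √β, by positivity, fun u u' hu => ?_⟩
  simp only [div_one] at hu ⊢
  convert hu.sup_bound hβ using 5
  rw [one_pow, one_mul, ← integral_const_mul]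
  exact integral_add hu.2.1.integrable_sq (hu.1.integrable_sq.const_mul β)

/-- With `A = ∫ u'²` and `B = ∫ u²`, Poincaré gives `B ≤ A`, hence `A + B ≤ 2/(1-δ) (A - δ B)`. This
reduces the claim to the sup bound with `β = 1` and explains the extra factor `√(2/(1-δ))`. -/
theorem secondAdmissible_nonempty {δ : ℝ} (hδ : 0 ≤ δ) (h1 : δ < 1) : (secondAdmissible δ).Nonempty := by
  have hd : 0 < 1 - δ := by linarith
  refine ⟨(8 + 2 / √1) * √(2 / (1 - δ)), by positivity, fun u u' hu h0 => ?_⟩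
  refine (hu.sup_bound one_pos).trans (ENNReal.ofReal_le_ofReal ?_)
  have hp := (hu.clm_comp Complex.ofRealCLM).poincare (by
    rw [Complex.ofRealCLM.integral_comp_comm (hu.1.integrable (by norm_num)), h0, map_zero])
  simp only [Complex.ofRealCLM_apply, Complex.norm_real, Real.norm_eq_abs, sq_abs] at hp
  rw [integral_sub hu.2.1.integrable_sq (hu.1.integrable_sq.const_mul δ), integral_const_mul]
  generalize ∫ x, u' x ^ 2 ∂(periodMeasure (2 * Real.pi)) = A at *
  have hB : 0 ≤ ∫ x, u x ^ 2 ∂(periodMeasure (2 * Real.pi)) :=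
    integral_nonneg fun _ => sq_nonneg _
  generalize ∫ x, u x ^ 2 ∂(periodMeasure (2 * Real.pi)) = B at *
  gcongr ?_ * _
  rw [mul_assoc, ← Real.sqrt_mul (by positivity)]
  gcongr
  rw [div_mul_eq_mul_div, le_div_iff₀ hd]
  nlinarith [mul_nonneg (by linarith : 0 ≤ 1 + δ) (sub_nonneg.mpr hp)]

/-! ### Integral identities for the lifting in `γ` and the semiclassical constant. -/

theorem lintegral_ofReal_sub_sq (r : ℝ) :
    ∫⁻ ξ : ℝ, ENNReal.ofReal (r - ξ ^ 2) = ENNReal.ofReal (4 / 3 * (max r 0) ^ (3 / 2 : ℝ)) := by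
  rcases le_or_gt r 0 with hr | hr
  · rw [max_eq_right hr, Real.zero_rpow (by norm_num), mul_zero, ENNReal.ofReal_zero,
      lintegral_eq_zero_of_ae_eq_zero]
    exact ae_of_all _ fun ξ => ENNReal.ofReal_of_nonpos (by nlinarith [sq_nonneg ξ])
  have hs : 0 < √r := Real.sqrt_pos.mpr hr
  have hsq : √r ^ 2 = r := Real.sq_sqrt hr.le
  have h1 : ∫⁻ ξ : ℝ, ENNReal.ofReal (r - ξ ^ 2)
      = ∫⁻ ξ in Set.Ioc (-√r) √r, ENNReal.ofReal (r - ξ ^ 2) := by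
    rw [← lintegral_indicator measurableSet_Ioc]
    congr 1
    ext ξ
    by_cases h : ξ ∈ Set.Ioc (-√r) √r
    · rw [Set.indicator_of_mem h]
    · rw [Set.indicator_of_notMem h]
      refine ENNReal.ofReal_of_nonpos ?_
      rw [Set.mem_Ioc, not_and_or, not_lt, not_le] at h
      rcases h with h | h <;> nlinarith
  have hint : IntegrableOn (fun ξ : ℝ => r - ξ ^ 2) (Set.Ioc (-√r) √r) :=
    (Continuous.integrableOn_Icc (by fun_prop)).mono_set Set.Ioc_subset_Icc_self
  rw [h1, ← ofReal_integral_eq_lintegral_ofReal hint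
    ((ae_restrict_mem measurableSet_Ioc).mono fun ξ hξ => by
      have h2 := hξ.1
      have h3 := hξ.2
      simp only [Pi.zero_apply]
      nlinarith),
    ← intervalIntegral.integral_of_le (by linarith), intervalIntegral.integral_sub (by simp)
      (by simp), intervalIntegral.integral_const, integral_pow, max_eq_left hr.le]
  congr 1
  rw [show (3 / 2 : ℝ) = 1 + 1 / 2 by norm_num, Real.rpow_add hr, Real.rpow_one,
    ← Real.sqrt_eq_rpow, smul_eq_mul]
  have h3 : √r ^ 3 = r * √r := by rw [pow_succ, hsq]
  push_cast
  linear_combination (2 / 3 : ℝ) * -h3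

theorem lintegral_rpow_mul_sub {γ s : ℝ} (hγ : 1 < γ) (hs : 0 < s) :
    ∫⁻ t in Set.Ioi (0 : ℝ), ENNReal.ofReal (γ * (γ - 1) * t ^ (γ - 2)) * ENNReal.ofReal (s - t)
      = ENNReal.ofReal (s ^ γ) := by
  have h0 : ∀ t : ℝ, 0 < t → 0 ≤ γ * (γ - 1) * t ^ (γ - 2) := fun t ht =>
    mul_nonneg (mul_nonneg (by linarith) (by linarith)) (Real.rpow_nonneg ht.le _)
  have h1 : ∫⁻ t in Set.Ioi (0 : ℝ),
        ENNReal.ofReal (γ * (γ - 1) * t ^ (γ - 2)) * ENNReal.ofReal (s - t)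
      = ∫⁻ t in Set.Ioc 0 s, ENNReal.ofReal (γ * (γ - 1) * t ^ (γ - 2) * (s - t)) := by
    rw [← lintegral_indicator measurableSet_Ioc, ← lintegral_indicator measurableSet_Ioi]
    congr 1
    ext t
    by_cases h : t ∈ Set.Ioi 0
    · rw [Set.indicator_of_mem h]
      by_cases h' : t ≤ s
      · rw [Set.indicator_of_mem (show t ∈ Set.Ioc 0 s from ⟨h, h'⟩), ENNReal.ofReal_mul (h0 t h)]
      · rw [Set.indicator_of_notMem (fun H => h' H.2), ENNReal.ofReal_of_nonpos (p := s - t)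
          (by linarith), mul_zero]
    · rw [Set.indicator_of_notMem h, Set.indicator_of_notMem fun H => h H.1]
  have e : ∀ t ∈ Set.Ioc 0 s, γ * (γ - 1) * t ^ (γ - 2) * (s - t)
      = γ * (γ - 1) * s * t ^ (γ - 2) - γ * (γ - 1) * t ^ (γ - 1) := fun t ht => by
    rw [show γ - 1 = γ - 2 + 1 by ring, Real.rpow_add ht.1, Real.rpow_one]
    ring
  have i1 : IntervalIntegrable (fun t : ℝ => γ * (γ - 1) * s * t ^ (γ - 2)) volume 0 s :=
    (intervalIntegral.intervalIntegrable_rpow' (by linarith)).const_mul _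
  have i2 : IntervalIntegrable (fun t : ℝ => γ * (γ - 1) * t ^ (γ - 1)) volume 0 s :=
    (intervalIntegral.intervalIntegrable_rpow' (by linarith)).const_mul _
  have hint : IntegrableOn (fun t : ℝ => γ * (γ - 1) * t ^ (γ - 2) * (s - t)) (Set.Ioc 0 s) :=
    ((intervalIntegrable_iff_integrableOn_Ioc_of_le hs.le).mp (i1.sub i2)).congr_fun
      (fun t ht => (e t ht).symm) measurableSet_Ioc
  rw [h1, ← ofReal_integral_eq_lintegral_ofReal hint
    ((ae_restrict_mem measurableSet_Ioc).mono fun t ht =>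
      mul_nonneg (h0 t ht.1) (by linarith [ht.2])), setIntegral_congr_fun measurableSet_Ioc e,
    ← intervalIntegral.integral_of_le hs.le, intervalIntegral.integral_sub i1 i2,
    intervalIntegral.integral_const_mul, intervalIntegral.integral_const_mul,
    integral_rpow (Or.inl (by linarith)), integral_rpow (Or.inl (by linarith))]
  congr 1
  have hγ1 : γ - 1 ≠ 0 := by linarith
  rw [Real.zero_rpow (by linarith), Real.zero_rpow (by linarith),
    show γ - 2 + 1 = γ - 1 by ring, show γ - 1 + 1 = γ by ring, Real.rpow_sub_one hs.ne']
  field_simp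
  ring

/-- The power `s_+^γ` with `γ ≥ 1` is a superposition of the functions `(s - t)_+`, `t ≥ 0`. -/
theorem exists_measure_lintegral_sub {γ : ℝ} (hγ : 1 ≤ γ) :
    ∃ τ : Measure ℝ, SFinite τ ∧
      ∀ s : ℝ, ∫⁻ t, ENNReal.ofReal (s - t) ∂τ = ENNReal.ofReal ((max s 0) ^ γ) := by
  rcases hγ.eq_or_lt with rfl | hγ
  -- At `γ = 1` the density `γ (γ - 1) t^(γ - 2)` degenerates, and its role is taken by a unit mass
  -- at zero.
  · refine ⟨Measure.dirac 0, inferInstance, fun s => ?_⟩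
    rw [lintegral_dirac, sub_zero, Real.rpow_one, ENNReal.ofReal_max, ENNReal.ofReal_zero,
      max_eq_left zero_le]
  · have hm : Measurable fun t : ℝ => ENNReal.ofReal (γ * (γ - 1) * t ^ (γ - 2)) := by fun_prop
    refine ⟨(volume.restrict (Set.Ioi 0)).withDensity
      fun t => ENNReal.ofReal (γ * (γ - 1) * t ^ (γ - 2)), inferInstance, fun s => ?_⟩
    rw [lintegral_withDensity_eq_lintegral_mul _ hm (by fun_prop)]
    simp only [Pi.mul_apply]
    rcases le_or_gt s 0 with hs | hs
    · rw [max_eq_right hs, Real.zero_rpow (by linarith), ENNReal.ofReal_zero,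
        lintegral_eq_zero_of_ae_eq_zero]
      filter_upwards [ae_restrict_mem measurableSet_Ioi] with t ht
      have ht' : 0 < t := ht
      rw [ENNReal.ofReal_of_nonpos (p := s - t) (by linarith), mul_zero, Pi.zero_apply]
    · rw [max_eq_left hs.le, lintegral_rpow_mul_sub hγ hs]

theorem integrable_max_sub_sq_rpow {γ : ℝ} (hγ : 1 ≤ γ) (s : ℝ) :
    Integrable fun ξ : ℝ => (max (s - ξ ^ 2) 0) ^ γ := by
  refine Continuous.integrable_of_hasCompactSupport
    (Continuous.rpow_const (by fun_prop) fun _ => Or.inr (by linarith)) ?_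
  refine HasCompactSupport.intro (isCompact_Icc (a := -√s) (b := √s)) fun ξ hξ => ?_
  have : s - ξ ^ 2 ≤ 0 := by
    by_contra! h
    exact hξ (Set.mem_Icc.mpr (abs_le.mp (Real.abs_le_sqrt (by linarith))))
  rw [max_eq_right this, Real.zero_rpow (by linarith)]

theorem integral_max_sub_sq_rpow {γ s : ℝ} (hγ : 1 ≤ γ) (hs : 0 ≤ s) :
    ∫ ξ : ℝ, (max (s - ξ ^ 2) 0) ^ γ
      = s ^ (γ + 1 / 2) * ∫ ξ : ℝ, (max (1 - ξ ^ 2) 0) ^ γ := by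
  rcases hs.eq_or_lt with rfl | hs
  · rw [Real.zero_rpow (by linarith), zero_mul]
    refine integral_eq_zero_of_ae (ae_of_all _ fun ξ => ?_)
    simp only [Pi.zero_apply]
    rw [max_eq_right (by nlinarith [sq_nonneg ξ]), Real.zero_rpow (by linarith)]
  · have h := Measure.integral_comp_mul_left (fun ξ : ℝ => (max (s - ξ ^ 2) 0) ^ γ) √s
    have hsq : 0 < √s := Real.sqrt_pos.mpr hs
    have e : ∀ ξ : ℝ, (max (s - (√s * ξ) ^ 2) 0) ^ γ = s ^ γ * (max (1 - ξ ^ 2) 0) ^ γ := by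
      intro ξ
      rw [mul_pow, Real.sq_sqrt hs.le, ← Real.mul_rpow hs.le (le_max_right _ _),
        mul_max_of_nonneg _ _ hs.le]
      ring_nf
    simp only [e, integral_const_mul] at h
    rw [abs_of_pos (inv_pos.mpr hsq), smul_eq_mul] at h
    rw [Real.rpow_add hs, ← Real.sqrt_eq_rpow]
    generalize ∫ ξ : ℝ, (max (1 - ξ ^ 2) 0) ^ γ = I at *
    rw [mul_right_comm, h]
    field_simp

/-- Write `(4/3)(s - t)_+^{3/2}` as `∫ (s - t - ξ²)_+ dξ` and integrate over `t` first: the inner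
integral is `(s - ξ²)_+^γ`, and scaling in `ξ` extracts the power of `s`. -/
theorem integral_max_sub_rpow_three_halves {γ : ℝ} (hγ : 1 ≤ γ) {τ : Measure ℝ} [SFinite τ]
    (hτ : ∀ s : ℝ, ∫⁻ t, ENNReal.ofReal (s - t) ∂τ = ENNReal.ofReal ((max s 0) ^ γ))
    {s : ℝ} (hs : 0 ≤ s) :
    Integrable (fun t => (max (s - t) 0) ^ (3 / 2 : ℝ)) τ ∧
      4 / 3 * ∫ t, (max (s - t) 0) ^ (3 / 2 : ℝ) ∂τ
        = s ^ (γ + 1 / 2) * ∫ ξ : ℝ, (max (1 - ξ ^ 2) 0) ^ γ := by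
  have hI : 0 ≤ ∫ ξ : ℝ, (max (1 - ξ ^ 2) 0) ^ γ :=
    integral_nonneg fun ξ => Real.rpow_nonneg (le_max_right _ _) _
  have h1 : ∫⁻ t, ENNReal.ofReal (4 / 3 * (max (s - t) 0) ^ (3 / 2 : ℝ)) ∂τ
      = ENNReal.ofReal (s ^ (γ + 1 / 2) * ∫ ξ : ℝ, (max (1 - ξ ^ 2) 0) ^ γ) := by
    simp only [← lintegral_ofReal_sub_sq]
    rw [lintegral_lintegral_swap (by fun_prop)]
    simp only [sub_right_comm s _ (_ ^ 2), hτ]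
    rw [← ofReal_integral_eq_lintegral_ofReal (integrable_max_sub_sq_rpow hγ s)
      (ae_of_all _ fun ξ => Real.rpow_nonneg (le_max_right _ _) _),
      integral_max_sub_sq_rpow hγ hs]
  have hn : ∀ t, 0 ≤ 4 / 3 * (max (s - t) 0) ^ (3 / 2 : ℝ) := fun t =>
    mul_nonneg (by norm_num) (Real.rpow_nonneg (le_max_right _ _) _)
  have hmeas : AEStronglyMeasurable (fun t => 4 / 3 * (max (s - t) 0) ^ (3 / 2 : ℝ)) τ :=
    Measurable.aestronglyMeasurable (by fun_prop)
  have hint : Integrable (fun t => 4 / 3 * (max (s - t) 0) ^ (3 / 2 : ℝ)) τ := by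
    refine ⟨hmeas, ?_⟩
    rw [hasFiniteIntegral_iff_ofReal (ae_of_all _ hn), h1]
    exact ENNReal.ofReal_lt_top
  refine ⟨?_, ?_⟩
  · have := hint.const_mul (3 / 4)
    refine this.congr (ae_of_all _ fun t => ?_)
    ring
  · rw [← integral_const_mul, integral_eq_lintegral_of_nonneg_ae (ae_of_all _ hn) hmeas, h1,
      ENNReal.toReal_ofReal (mul_nonneg (Real.rpow_nonneg hs _) hI)]

/-! ### Interpolation inequalities for vector functions -/

theorem VecL2.norm_sq_eq_integral {L : ℝ} {M : ℕ} (u : VecL2 L M) :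
    ‖u‖ ^ 2 = ∫ x, ‖u x‖ ^ 2 ∂(periodMeasure L) := by
  rw [@norm_sq_eq_re_inner ℂ, L2.inner_def, ← integral_re (L2.integrable_inner u u)]
  congr 1
  ext x
  exact (@norm_sq_eq_re_inner ℂ _ _ _ _ (u x)).symm

theorem VecL2.integrable_norm_sq {L : ℝ} {M : ℕ} (u : VecL2 L M) :
    Integrable (fun x => ‖u x‖ ^ 2) (periodMeasure L) := (Lp.memLp u).integrable_norm_pow (by simp)

theorem ae_sq_le_of_eLpNorm_top_sq_le {α : Type*} [MeasurableSpace α] {μ : Measure α}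
    {f : α → ℝ} {B : ℝ} (hB : 0 ≤ B) (h : eLpNorm f ⊤ μ ^ 2 ≤ ENNReal.ofReal B) :
    ∀ᵐ x ∂μ, f x ^ 2 ≤ B := by
  rw [eLpNorm_exponent_top] at h
  filter_upwards [ae_le_eLpNormEssSup (f := f) (μ := μ)] with x hx
  have h1 : ‖f x‖ₑ ^ 2 ≤ ENNReal.ofReal B := le_trans (by gcongr) h
  rw [← ofReal_norm, ← ENNReal.ofReal_pow (norm_nonneg _), ENNReal.ofReal_le_ofReal_iff hB,
    Real.norm_eq_abs, sq_abs] at h1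
  exact h1

/-- The real-linear functional `u ↦ Re ⟨e, u⟩`. -/
noncomputable def reInnerCLM {M : ℕ} (e : EuclideanSpace ℂ (Fin M)) :
    EuclideanSpace ℂ (Fin M) →L[ℝ] ℝ :=
  Complex.reCLM.comp ((innerSL ℂ e).restrictScalars ℝ)

@[simp] theorem reInnerCLM_apply {M : ℕ} (e u : EuclideanSpace ℂ (Fin M)) :
    reInnerCLM e u = (inner ℂ e u).re := rfl

theorem reInnerCLM_sq_le {M : ℕ} (e u : EuclideanSpace ℂ (Fin M)) :
    reInnerCLM e u ^ 2 ≤ ‖e‖ ^ 2 * ‖u‖ ^ 2 := by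
  rw [← mul_pow, ← sq_abs]
  gcongr
  exact (Complex.abs_re_le_norm _).trans (norm_inner_le_norm e u)

theorem sqrt_energy_bound {K X Y A B n : ℝ} (hK : 0 ≤ K) (hn : 0 ≤ n)
    (hX : X ≤ n ^ 2 * A) (hY : Y ≤ n ^ 2 * B) :
    K * √X * √Y ≤ K * √A * √B * n ^ 2 := by
  have h1 : √X ≤ n * √A := by
    rw [← Real.sqrt_sq hn, ← Real.sqrt_mul (sq_nonneg n)]
    exact Real.sqrt_le_sqrt (by simpa [Real.sqrt_sq hn] using hX)
  have h2 : √Y ≤ n * √B := by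
    rw [← Real.sqrt_sq hn, ← Real.sqrt_mul (sq_nonneg n)]
    exact Real.sqrt_le_sqrt (by simpa [Real.sqrt_sq hn] using hY)
  calc K * √X * √Y ≤ K * (n * √A) * (n * √B) := by gcongr
    _ = _ := by ring

/-- The vector-valued interpolation inequality with energy `‖u'‖² + c ‖u‖²` and constant `K`. -/
def VectorInterpolation {M : ℕ} (L c K : ℝ) (S : Submodule ℂ (VecL2 L M)) : Prop :=
  ∀ u u' : VecL2 L M, u ∈ S → HasPeriodicWeakDeriv L u u' → ∀ e : EuclideanSpace ℂ (Fin M),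
    ∀ᵐ x ∂(periodMeasure L),
      (inner ℂ e (u x)).re ^ 2 ≤ K * √(‖u'‖ ^ 2 + c * ‖u‖ ^ 2) * √(‖u‖ ^ 2) * ‖e‖ ^ 2

theorem integral_reInnerCLM_sq_le {L : ℝ} {M : ℕ} (e : EuclideanSpace ℂ (Fin M))
    (u : VecL2 L M) :
    ∫ x, reInnerCLM e (u x) ^ 2 ∂(periodMeasure L) ≤ ‖e‖ ^ 2 * ‖u‖ ^ 2 := by
  rw [VecL2.norm_sq_eq_integral, ← integral_const_mul]
  exact integral_mono (((reInnerCLM e).comp_memLp' (Lp.memLp u)).integrable_sq)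
    (u.integrable_norm_sq.const_mul _) fun x => reInnerCLM_sq_le e (u x)

/-- Apply the scalar inequality to `Re ⟨e, u⟩`. Both energy terms have non-negative coefficients, so
Cauchy–Schwarz in `ℂ^M` bounds each separately. -/
theorem vectorInterpolation_of_mem_firstAdmissible {M : ℕ} {α β K : ℝ} (hβ : 0 ≤ β)
    (hK : K ∈ firstAdmissible α β) :
    VectorInterpolation (M := M) (2 * Real.pi / α) (α ^ 2 * β) K ⊤ := by
  intro u u' _ hu e
  have hf := hu.clm_comp (reInnerCLM e)
  have h := hK.2 _ _ hf
  have h2 := ae_sq_le_of_eLpNorm_top_sq_le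
    (mul_nonneg (mul_nonneg hK.1 (Real.sqrt_nonneg _)) (Real.sqrt_nonneg _)) h
  filter_upwards [h2] with x hx
  refine hx.trans (sqrt_energy_bound hK.1 (norm_nonneg e) ?_ (integral_reInnerCLM_sq_le e u))
  rw [integral_add hf.2.1.integrable_sq (hf.1.integrable_sq.const_mul _), integral_const_mul,
    mul_add, mul_left_comm]
  gcongr
  · exact integral_reInnerCLM_sq_le e u'
  · exact integral_reInnerCLM_sq_le e u

theorem HasPeriodicWeakDeriv.poincare_vector {M : ℕ} {u u' : ℝ → EuclideanSpace ℂ (Fin M)}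
    (hu : HasPeriodicWeakDeriv (2 * Real.pi) u u')
    (h0 : ∫ x, u x ∂(periodMeasure (2 * Real.pi)) = 0) :
    ∫ x, ‖u x‖ ^ 2 ∂(periodMeasure (2 * Real.pi))
      ≤ ∫ x, ‖u' x‖ ^ 2 ∂(periodMeasure (2 * Real.pi)) := by
  have hc := fun i => hu.clm_comp ((EuclideanSpace.proj (𝕜 := ℂ) i).restrictScalars ℝ)
  have h0i : ∀ i, ∫ x, (EuclideanSpace.proj (𝕜 := ℂ) i).restrictScalars ℝ (u x)
      ∂(periodMeasure (2 * Real.pi)) = 0 := fun i => by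
    rw [ContinuousLinearMap.integral_comp_comm _ (hu.1.integrable (by norm_num)), h0, map_zero]
  simp only [ContinuousLinearMap.coe_restrictScalars', PiLp.proj_apply] at hc h0i
  simp only [EuclideanSpace.norm_sq_eq]
  rw [integral_finsetSum _ fun i _ => (hc i).1.integrable_norm_pow (by simp),
    integral_finsetSum _ fun i _ => (hc i).2.1.integrable_norm_pow (by simp)]
  refine Finset.sum_le_sum fun i _ => (hc i).poincare (h0i i)

theorem integral_eq_zero_of_mem_meanZeroSpace {L : ℝ} {M : ℕ} (hL : L ≠ 0) {u : VecL2 L M}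
    (hu : u ∈ meanZeroSpace L M) : ∫ x, u x ∂(periodMeasure L) = 0 := by
  have h : ((1 / L : ℝ) : ℂ) • ∫ x, u x ∂(periodMeasure L) = 0 := hu
  refine (smul_eq_zero.mp h).resolve_left ?_
  exact_mod_cast one_div_ne_zero hL

theorem norm_sub_reInner_smul_sq {M : ℕ} {e : EuclideanSpace ℂ (Fin M)} (he : e ≠ 0)
    (u : EuclideanSpace ℂ (Fin M)) :
    ‖u - (reInnerCLM e u / ‖e‖ ^ 2) • e‖ ^ 2 = ‖u‖ ^ 2 - reInnerCLM e u ^ 2 / ‖e‖ ^ 2 := by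
  have hn : ‖e‖ ≠ 0 := norm_ne_zero_iff.mpr he
  rw [@norm_sub_sq ℂ, norm_smul, RCLike.real_smul_eq_coe_smul (K := ℂ), inner_smul_right,
    ← inner_conj_symm, mul_pow, Real.norm_eq_abs, sq_abs]
  simp only [reInnerCLM_apply, RCLike.re_to_complex, Complex.coe_algebraMap, Complex.re_ofReal_mul,
    Complex.conj_re]
  field_simp
  ring

/-- The term `-δ ‖u‖²` has the wrong sign for a termwise bound. Instead `u` is split into its
component along `e` and the real-orthogonal remainder; the remainder has mean zero, so by Poincaré
its energy is non-negative for `δ ≤ 1` and can be dropped. -/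
theorem vectorInterpolation_of_mem_secondAdmissible {M : ℕ} {δ K : ℝ} (hδ : δ ≤ 1)
    (hK : K ∈ secondAdmissible δ) :
    VectorInterpolation (2 * Real.pi) (-δ) K (meanZeroSpace (2 * Real.pi) M) := by
  intro u u' hS hu e
  rcases eq_or_ne e 0 with rfl | he
  · simp
  have hu0 := integral_eq_zero_of_mem_meanZeroSpace Real.two_pi_pos.ne' hS
  have hui : Integrable u (periodMeasure (2 * Real.pi)) := hu.1.integrable (by norm_num)
  have hf := hu.clm_comp (reInnerCLM e)
  have hf0 : ∫ x, reInnerCLM e (u x) ∂(periodMeasure (2 * Real.pi)) = 0 := by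
    rw [ContinuousLinearMap.integral_comp_comm _ hui, hu0, map_zero]
  have h := hK.2 _ _ hf hf0
  have h2 := ae_sq_le_of_eLpNorm_top_sq_le
    (mul_nonneg (mul_nonneg hK.1 (Real.sqrt_nonneg _)) (Real.sqrt_nonneg _)) h
  have hn : 0 < ‖e‖ ^ 2 := by positivity
  -- Real-orthogonal projection onto the complement of `e`; being linear, it commutes with weak
  -- derivatives and means.
  let T : EuclideanSpace ℂ (Fin M) →L[ℝ] EuclideanSpace ℂ (Fin M) :=
    ContinuousLinearMap.id ℝ _ - ((‖e‖ ^ 2)⁻¹ • reInnerCLM e).smulRight e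
  have hT : ∀ v, ‖T v‖ ^ 2 = ‖v‖ ^ 2 - reInnerCLM e v ^ 2 / ‖e‖ ^ 2 := fun v => by
    rw [← norm_sub_reInner_smul_sq he]
    simp [T, div_eq_inv_mul]
  have hg := (hu.clm_comp T).poincare_vector (by
    rw [ContinuousLinearMap.integral_comp_comm _ hui, hu0, map_zero])
  simp only [hT] at hg
  rw [integral_sub u.integrable_norm_sq (hf.1.integrable_sq.div_const _),
    integral_sub u'.integrable_norm_sq (hf.2.1.integrable_sq.div_const _), integral_div,
    integral_div, ← VecL2.norm_sq_eq_integral, ← VecL2.norm_sq_eq_integral] at hg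
  have hp := integral_reInnerCLM_sq_le e u
  filter_upwards [h2] with x hx
  refine hx.trans (sqrt_energy_bound hK.1 (norm_nonneg e) ?_ hp)
  rw [integral_sub hf.2.1.integrable_sq (hf.1.integrable_sq.const_mul _), integral_const_mul]
  generalize ∫ x, reInnerCLM e (u x) ^ 2 ∂(periodMeasure (2 * Real.pi)) = X at *
  generalize ∫ x, reInnerCLM e (u' x) ^ 2 ∂(periodMeasure (2 * Real.pi)) = Y at *
  have hg' : ‖e‖ ^ 2 * ‖u‖ ^ 2 - X ≤ ‖e‖ ^ 2 * ‖u'‖ ^ 2 - Y := by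
    have := mul_le_mul_of_nonneg_left hg hn.le
    rwa [mul_sub, mul_sub, mul_div_cancel₀ _ hn.ne', mul_div_cancel₀ _ hn.ne'] at this
  nlinarith [mul_nonneg (sub_nonneg.mpr hδ) (sub_nonneg.mpr hp)]

/-! ### Orthonormal families -/

theorem hasPeriodicWeakDeriv_zero_Lp {L : ℝ} {M : ℕ} :
    HasPeriodicWeakDeriv L (0 : VecL2 L M) (0 : VecL2 L M) := by
  have e : ∀ g : ℝ → ℝ, ∫ x, g x • (0 : VecL2 L M) x ∂(periodMeasure L) = 0 := fun g =>
    integral_eq_zero_of_ae ((Lp.coeFn_zero (EuclideanSpace ℂ (Fin M)) 2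
      (periodMeasure L)).mono fun x hx => by simp only [hx, Pi.zero_apply, smul_zero])
  exact ⟨Lp.memLp _, Lp.memLp _, fun ψ _ _ => by rw [e, e, neg_zero]⟩

theorem HasPeriodicWeakDeriv.sum_Lp {ι : Type*} {L : ℝ} {M : ℕ} {φ φ' : ι → VecL2 L M}
    (h : ∀ j, HasPeriodicWeakDeriv L (φ j) (φ' j)) (ξ : ι → ℂ) (s : Finset ι) :
    HasPeriodicWeakDeriv L (∑ j ∈ s, ξ j • φ j : VecL2 L M) (∑ j ∈ s, ξ j • φ' j : VecL2 L M) := by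
  classical
  induction s using Finset.induction_on with
  | empty => simpa using hasPeriodicWeakDeriv_zero_Lp
  | insert i s hi ih =>
    rw [Finset.sum_insert hi, Finset.sum_insert hi]
    exact ((h i).smul_Lp _).add_Lp ih

theorem norm_sq_sum_smul {ι H : Type*} [Fintype ι] [NormedAddCommGroup H] [InnerProductSpace ℂ H]
    (φ : ι → H) (ξ : ι → ℂ) :
    ‖∑ j, ξ j • φ j‖ ^ 2 = (∑ i, ∑ j, star (ξ i) * ξ j * inner ℂ (φ i) (φ j)).re := by
  rw [@norm_sq_eq_re_inner ℂ, sum_inner]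
  simp only [inner_sum, inner_smul_left, inner_smul_right, RCLike.re_to_complex]
  congr 1
  refine Finset.sum_congr rfl fun i _ => Finset.sum_congr rfl fun j _ => ?_
  rw [Complex.star_def]
  ring

/-- The matrix `⟨φ_i', φ_j'⟩ + c ⟨φ_i, φ_j⟩`. -/
noncomputable def energyMatrix {ι H : Type*} [NormedAddCommGroup H] [InnerProductSpace ℂ H] (c : ℝ)
    (φ φ' : ι → H) (i j : ι) : ℂ :=
  inner ℂ (φ' i) (φ' j) + c * inner ℂ (φ i) (φ j)

/-- The exceptional null set must not depend on `e` and `ξ`, which will be chosen depending on `x`.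
A countable dense set of parameters gives a common null set, and both sides are continuous in the
parameters. -/
theorem ae_forall_interpolation {ι : Type*} [Fintype ι] {L c K : ℝ} {M : ℕ}
    {S : Submodule ℂ (VecL2 L M)} (hS : VectorInterpolation L c K S) {φ φ' : ι → VecL2 L M}
    (hφ : Orthonormal ℂ φ) (hφS : ∀ j, φ j ∈ S) (hd : ∀ j, HasPeriodicWeakDeriv L (φ j) (φ' j)) :
    ∀ᵐ x ∂(periodMeasure L), ∀ (e : EuclideanSpace ℂ (Fin M)) (ξ : ι → ℂ),
      (∑ j, ξ j * inner ℂ e (φ j x)).re ^ 2 ≤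
        K * √(∑ i, ∑ j, star (ξ i) * ξ j * energyMatrix c φ φ' i j).re * √(∑ j, ‖ξ j‖ ^ 2)
          * ‖e‖ ^ 2 := by
  have key : ∀ p : EuclideanSpace ℂ (Fin M) × (ι → ℂ), ∀ᵐ x ∂(periodMeasure L),
      (∑ j, p.2 j * inner ℂ p.1 (φ j x)).re ^ 2 ≤
        K * √(∑ i, ∑ j, star (p.2 i) * p.2 j * energyMatrix c φ φ' i j).re
          * √(∑ j, ‖p.2 j‖ ^ 2) * ‖p.1‖ ^ 2 := by
    rintro ⟨e, ξ⟩
    have h := hS (∑ j, ξ j • φ j) (∑ j, ξ j • φ' j)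
      (S.sum_mem fun j _ => S.smul_mem _ (hφS j)) (HasPeriodicWeakDeriv.sum_Lp hd ξ _) e
    have hn : ‖∑ j, ξ j • φ j‖ ^ 2 = ∑ j, ‖ξ j‖ ^ 2 := by
      classical
      rw [norm_sq_sum_smul]
      simp only [orthonormal_iff_ite.mp hφ, mul_ite, mul_one, mul_zero, Finset.sum_ite_eq,
        Finset.mem_univ, if_true, Complex.re_sum]
      refine Finset.sum_congr rfl fun j _ => ?_
      rw [mul_comm, Complex.star_def, Complex.mul_conj, Complex.normSq_eq_norm_sq,
        Complex.ofReal_re]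
    have he : ‖∑ j, ξ j • φ' j‖ ^ 2 + c * ‖∑ j, ξ j • φ j‖ ^ 2
        = (∑ i, ∑ j, star (ξ i) * ξ j * energyMatrix c φ φ' i j).re := by
      rw [norm_sq_sum_smul, norm_sq_sum_smul, ← Complex.re_ofReal_mul, ← Complex.add_re,
        Finset.mul_sum, ← Finset.sum_add_distrib]
      congr 1
      refine Finset.sum_congr rfl fun i _ => ?_
      rw [Finset.mul_sum, ← Finset.sum_add_distrib]
      refine Finset.sum_congr rfl fun j _ => ?_
      rw [energyMatrix]
      ring
    rw [hn] at h he
    rw [he] at h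
    have hc : ∀ᵐ x ∂(periodMeasure L), (∑ j, ξ j • φ j : VecL2 L M) x = ∑ j, ξ j • φ j x := by
      have h1 := Lp.coeFn_finsetSum (p := 2) (μ := periodMeasure L) Finset.univ fun j => ξ j • φ j
      have h2 : ∀ᵐ x ∂(periodMeasure L), ∀ j, (ξ j • φ j : VecL2 L M) x = ξ j • φ j x :=
        ae_all_iff.mpr fun j => Lp.coeFn_smul _ _
      filter_upwards [h1, h2] with x hx1 hx2
      rw [hx1]
      simp only [Finset.sum_apply, hx2]
    filter_upwards [h, hc] with x hx hx2
    rw [hx2, inner_sum] at hx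
    simpa only [inner_smul_right] using hx
  have hall := ae_all_iff.mpr fun n : ℕ =>
    key (TopologicalSpace.denseSeq (EuclideanSpace ℂ (Fin M) × (ι → ℂ)) n)
  filter_upwards [hall] with x hx e ξ
  have hcl : IsClosed {p : EuclideanSpace ℂ (Fin M) × (ι → ℂ) |
      (∑ j, p.2 j * inner ℂ p.1 (φ j x)).re ^ 2 ≤
        K * √(∑ i, ∑ j, star (p.2 i) * p.2 j * energyMatrix c φ φ' i j).re
          * √(∑ j, ‖p.2 j‖ ^ 2) * ‖p.1‖ ^ 2} := by
    refine isClosed_le ?_ ?_ <;> fun_prop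
  have := hcl.closure_subset_iff.mpr (Set.range_subset_iff.mpr hx)
  rw [(TopologicalSpace.denseRange_denseSeq _).closure_range] at this
  exact this (Set.mem_univ (e, ξ))

/-! ### The pointwise trace inequality -/

theorem Matrix.IsHermitian.tracePow_eq {M : ℕ} {A : Matrix (Fin M) (Fin M) ℂ} (hA : A.IsHermitian)
    (s : ℝ) : tracePow A s = ∑ m, hA.eigenvalues m ^ s := by
  rw [tracePow, hA.cfc_eq, Matrix.IsHermitian.cfc, Unitary.conjStarAlgAut_apply,
    Matrix.trace_mul_cycle, Unitary.coe_star_mul_self, Matrix.one_mul, Matrix.trace_diagonal,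
    Complex.re_sum]
  simp

theorem Matrix.IsHermitian.dotProduct_mulVec_eq_sum {M : ℕ} {A : Matrix (Fin M) (Fin M) ℂ}
    (hA : A.IsHermitian) (p q : EuclideanSpace ℂ (Fin M)) :
    star p.ofLp ⬝ᵥ Matrix.mulVec A q.ofLp = ∑ m, (hA.eigenvalues m : ℂ) *
      (inner ℂ p (hA.eigenvectorBasis m) * inner ℂ (hA.eigenvectorBasis m) q) := by
  have h1 : q.ofLp = ∑ m, (inner ℂ (hA.eigenvectorBasis m) q : ℂ) •
      (hA.eigenvectorBasis m).ofLp := by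
    conv_lhs => rw [← hA.eigenvectorBasis.sum_repr' q]
    simp
  rw [h1, Matrix.mulVec_sum, dotProduct_sum]
  refine Finset.sum_congr rfl fun m _ => ?_
  rw [Matrix.mulVec_smul, hA.mulVec_eigenvectorBasis, dotProduct_smul,
    RCLike.real_smul_eq_coe_smul (K := ℂ), dotProduct_smul,
    EuclideanSpace.inner_eq_star_dotProduct p,
    dotProduct_comm (star p.ofLp)]
  simp only [smul_eq_mul, Complex.coe_algebraMap]
  ring

/-- For `ν > 0` the hypothesis says `ν³ ≤ K² Q`, and `w ν - ν³ / K²` is maximal at `ν = K √(w/3)`.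
The case `ν = 0` needs its own hypothesis because `√Q` says nothing about a negative `Q`. -/
theorem mul_le_of_sq_le_mul_sqrt {K Q ν w : ℝ} (hK : 0 ≤ K) (hν : 0 ≤ ν) (hQ : ν = 0 → Q = 0)
    (h : ν ^ 2 ≤ K * √Q * √ν) :
    w * ν ≤ 2 * K / (3 * √3) * (max w 0) ^ (3 / 2 : ℝ) + Q := by
  have hC : 0 ≤ 2 * K / (3 * √3) * (max w 0) ^ (3 / 2 : ℝ) := by
    have : 0 ≤ (max w 0) ^ (3 / 2 : ℝ) := Real.rpow_nonneg (le_max_right _ _) _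
    positivity
  rcases hν.eq_or_lt with h0 | hpos
  · rw [hQ h0.symm, ← h0]
    simpa using hC
  have hQ0 : 0 < Q := by
    by_contra! hn
    rw [Real.sqrt_eq_zero_of_nonpos hn, mul_zero, zero_mul] at h
    nlinarith
  have hK0 : 0 < K := by
    refine hK.lt_of_ne fun h0 => ?_
    rw [← h0, zero_mul, zero_mul] at h
    nlinarith
  have h3 : ν ^ 3 ≤ K ^ 2 * Q := by
    have h4 : (ν ^ 2) ^ 2 ≤ (K * √Q * √ν) ^ 2 := by gcongr
    rw [mul_pow, mul_pow, Real.sq_sqrt hQ0.le, Real.sq_sqrt hν] at h4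
    refine le_of_mul_le_mul_right ?_ hpos
    calc ν ^ 3 * ν = (ν ^ 2) ^ 2 := by ring
      _ ≤ _ := h4
  rcases le_or_gt w 0 with hw | hw
  · nlinarith
  set b : ℝ := K / √3 with hb
  have hb0 : 0 < b := by positivity
  have hb2 : 3 * b ^ 2 = K ^ 2 := by
    rw [hb, div_pow, Real.sq_sqrt (by norm_num)]
    ring
  have hr : (max w 0) ^ (3 / 2 : ℝ) = √w ^ 3 := by
    rw [max_eq_left hw.le, show (3 / 2 : ℝ) = 1 + 1 / 2 by norm_num, Real.rpow_add hw,
      Real.rpow_one, ← Real.sqrt_eq_rpow, pow_succ, Real.sq_sqrt hw.le]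
  rw [hr, show 2 * K / (3 * √3) = 2 / 3 * b by rw [hb]; field_simp]
  have hs := Real.sq_sqrt hw.le
  have hs0 := Real.sqrt_nonneg w
  set s := √w
  rw [← hs]
  -- Expands to `ν³ - 3 b² s² ν + 2 b³ s³ ≥ 0`, with a double zero at the maximiser `ν = b s`.
  have key : 0 ≤ (b * s - ν) ^ 2 * (2 * (b * s) + ν) := by positivity
  have hfin : 3 * b ^ 2 * (s ^ 2 * ν) ≤ 3 * b ^ 2 * (2 / 3 * b * s ^ 3 + Q) := by
    rw [← hb2] at h3
    nlinarith
  exact le_of_mul_le_mul_left hfin (by positivity)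

/-- Diagonalising `A` reduces the matrix inequality to one scalar inequality per eigenvector. The
weights `θ` select a subfamily; `θ² = θ` is what makes the left side and the `ℓ²` norm of the
coefficients the same `ν`. -/
theorem trace_sub_energy_le {ι : Type*} [Fintype ι] {M : ℕ} {A : Matrix (Fin M) (Fin M) ℂ}
    (hA : A.IsHermitian) {K : ℝ} (hK : 0 ≤ K) (p : ι → EuclideanSpace ℂ (Fin M)) (a : ι → ι → ℂ)
    (H : ∀ (e : EuclideanSpace ℂ (Fin M)) (ξ : ι → ℂ), (∑ j, ξ j * inner ℂ e (p j)).re ^ 2 ≤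
      K * √(∑ i, ∑ j, star (ξ i) * ξ j * a i j).re * √(∑ j, ‖ξ j‖ ^ 2) * ‖e‖ ^ 2)
    (θ : ι → ℝ) (hθ : ∀ j, θ j = 0 ∨ θ j = 1) (t : ℝ) :
    ∑ j, θ j * ((star (p j).ofLp ⬝ᵥ Matrix.mulVec A (p j).ofLp).re - t * ‖p j‖ ^ 2)
      - ∑ i, ∑ j, θ i * θ j * (a i j * inner ℂ (p j) (p i)).re
      ≤ 2 * K / (3 * √3) * ∑ m, (max (hA.eigenvalues m - t) 0) ^ (3 / 2 : ℝ) := by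
  set b := hA.eigenvectorBasis with hb
  have hθ2 : ∀ j, θ j ^ 2 = θ j := fun j => by rcases hθ j with h | h <;> simp [h]
  let ν : Fin M → ℝ := fun m => ∑ j, θ j * ‖(inner ℂ (b m) (p j) : ℂ)‖ ^ 2
  let Q : Fin M → ℝ := fun m => ∑ i, ∑ j, θ i * θ j *
    (a i j * (inner ℂ (p j) (b m) * inner ℂ (b m) (p i))).re
  have hθ0 : ∀ j, 0 ≤ θ j := fun j => by rcases hθ j with h | h <;> simp [h]
  have key : ∀ m, (hA.eigenvalues m - t) * ν m ≤
      2 * K / (3 * √3) * (max (hA.eigenvalues m - t) 0) ^ (3 / 2 : ℝ) + Q m := by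
    intro m
    -- With these coefficients the sum on the left is real and non-negative, so taking real parts
    -- loses nothing.
    have h := H (b m) fun j => θ j * inner ℂ (p j) (b m)
    have e1 : (∑ j, ((θ j : ℂ) * inner ℂ (p j) (b m)) * inner ℂ (b m) (p j)).re = ν m := by
      rw [Complex.re_sum]
      refine Finset.sum_congr rfl fun j _ => ?_
      rw [mul_assoc, Complex.re_ofReal_mul, ← inner_conj_symm (p j) (b m),
        Complex.conj_mul', ← Complex.ofReal_pow, Complex.ofReal_re]
    have e2 : ∑ j, ‖(θ j : ℂ) * inner ℂ (p j) (b m)‖ ^ 2 = ν m := by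
      refine Finset.sum_congr rfl fun j _ => ?_
      rw [norm_mul, mul_pow, Complex.norm_real, Real.norm_eq_abs, sq_abs, hθ2, norm_inner_symm]
    have e3 : (∑ i, ∑ j, star ((θ i : ℂ) * inner ℂ (p i) (b m)) * (θ j * inner ℂ (p j) (b m))
        * a i j).re = Q m := by
      rw [Complex.re_sum]
      refine Finset.sum_congr rfl fun i _ => ?_
      rw [Complex.re_sum]
      refine Finset.sum_congr rfl fun j _ => ?_
      rw [← Complex.re_ofReal_mul, star_mul', Complex.star_def, inner_conj_symm,
        Complex.conj_ofReal]
      congr 1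
      push_cast
      ring
    rw [e1, e2, e3, b.norm_eq_one, one_pow, mul_one] at h
    refine mul_le_of_sq_le_mul_sqrt hK
      (Finset.sum_nonneg fun j _ => mul_nonneg (hθ0 j) (sq_nonneg _)) (fun h0 => ?_) h
    have hz := (Finset.sum_eq_zero_iff_of_nonneg
      fun j _ => mul_nonneg (hθ0 j) (sq_nonneg _)).mp h0
    refine Finset.sum_eq_zero fun i hi => Finset.sum_eq_zero fun j _ => ?_
    rcases mul_eq_zero.mp (hz i hi) with h | h
    · rw [h, zero_mul, zero_mul]
    · rw [norm_eq_zero.mp (pow_eq_zero_iff (two_ne_zero)|>.mp h), mul_zero, mul_zero,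
        Complex.zero_re, mul_zero]
  have hsum := Finset.sum_le_sum fun m (_ : m ∈ Finset.univ) => key m
  rw [Finset.sum_add_distrib, ← Finset.mul_sum] at hsum
  -- Parseval for the eigenbasis reassembles the inner products.
  have hQ : ∑ m, Q m = ∑ i, ∑ j, θ i * θ j * (a i j * inner ℂ (p j) (p i)).re := by
    rw [Finset.sum_comm]
    refine Finset.sum_congr rfl fun i _ => ?_
    rw [Finset.sum_comm]
    refine Finset.sum_congr rfl fun j _ => ?_
    rw [← Finset.mul_sum, ← Complex.re_sum, ← Finset.mul_sum, b.sum_inner_mul_inner]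
  have hν : ∑ m, (hA.eigenvalues m - t) * ν m
      = ∑ j, θ j * ((star (p j).ofLp ⬝ᵥ Matrix.mulVec A (p j).ofLp).re - t * ‖p j‖ ^ 2) := by
    simp only [ν, Finset.mul_sum]
    rw [Finset.sum_comm]
    refine Finset.sum_congr rfl fun j _ => ?_
    rw [hA.dotProduct_mulVec_eq_sum, ← b.sum_sq_norm_inner_right (p j), Complex.re_sum,
      Finset.mul_sum, ← Finset.sum_sub_distrib, Finset.mul_sum]
    refine Finset.sum_congr rfl fun m _ => ?_
    rw [Complex.re_ofReal_mul, ← inner_conj_symm (p j), Complex.conj_mul', ← Complex.ofReal_pow,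
      Complex.ofReal_re]
    ring
  rw [hQ, hν] at hsum
  linarith

/-! ### Riesz means of finite orthonormal families of eigenfunctions -/

theorem integral_sub_mul_indicator {γ : ℝ} {τ : Measure ℝ}
    (hτ : ∀ s : ℝ, ∫⁻ t, ENNReal.ofReal (s - t) ∂τ = ENNReal.ofReal ((max s 0) ^ γ)) (s : ℝ) :
    Integrable (fun t => if t < s then (1 : ℝ) else 0) τ ∧
      Integrable (fun t => (if t < s then (1 : ℝ) else 0) * t) τ ∧
      s * (∫ t, if t < s then (1 : ℝ) else 0 ∂τ) - ∫ t, (if t < s then (1 : ℝ) else 0) * t ∂τ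
        = (max s 0) ^ γ := by
  have hn : ∀ r : ℝ, ∀ᵐ t ∂τ, 0 ≤ max (r - t) 0 := fun r => ae_of_all _ fun t => le_max_right _ _
  have hm : ∀ r : ℝ, Integrable (fun t => max (r - t) 0) τ := fun r => by
    refine ⟨Measurable.aestronglyMeasurable (by fun_prop), ?_⟩
    rw [hasFiniteIntegral_iff_ofReal (hn r)]
    simp only [ENNReal.ofReal_max, ENNReal.ofReal_zero, max_eq_left zero_le, hτ]
    exact ENNReal.ofReal_lt_top
  have hχ : Measurable fun t : ℝ => if t < s then (1 : ℝ) else 0 :=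
    Measurable.ite measurableSet_Iio measurable_const measurable_const
  have h1 : Integrable (fun t => if t < s then (1 : ℝ) else 0) τ := by
    -- `τ` is finite on `t < s` because `s + 1 - t` exceeds `1` there.
    refine (hm (s + 1)).mono' hχ.aestronglyMeasurable (ae_of_all _ fun t => ?_)
    split_ifs with h
    · rw [norm_one]
      exact le_max_of_le_left (by linarith)
    · rw [norm_zero]
      exact le_max_right _ _
  have e : ∀ t, (if t < s then (1 : ℝ) else 0) * t
      = s * (if t < s then (1 : ℝ) else 0) - max (s - t) 0 := fun t => by
    split_ifs with h
    · rw [max_eq_left (by linarith)]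
      ring
    · rw [max_eq_right (by linarith)]
      ring
  simp only [e]
  refine ⟨h1, (h1.const_mul s).sub (hm s), ?_⟩
  rw [integral_sub (h1.const_mul s) (hm s), integral_const_mul, sub_sub_cancel,
    integral_eq_lintegral_of_nonneg_ae (hn s) (hm s).aestronglyMeasurable]
  simp only [ENNReal.ofReal_max, ENNReal.ofReal_zero, max_eq_left zero_le, hτ]
  exact ENNReal.toReal_ofReal (Real.rpow_nonneg (le_max_right _ _) _)

/-- The energy matrix need not be diagonal, since it omits the potential. Its off-diagonal entries
are multiplied by `⟨φ_j, φ_i⟩` after integration in `x` and vanish, so only the diagonal eigenvalue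
identities are used. -/
theorem sum_rpow_le_of_eigenfamily {ι : Type*} [Fintype ι] {M : ℕ} {L c K γ : ℝ} (hγ : 1 ≤ γ)
    (hK : 0 ≤ K) {S : Submodule ℂ (VecL2 L M)} (hS : VectorInterpolation L c K S)
    {V : ℝ → Matrix (Fin M) (Fin M) ℂ} (hV : ∀ᵐ x ∂(periodMeasure L), (V x).PosSemidef)
    (hT : Integrable (fun x => tracePow (V x) (γ + 1 / 2)) (periodMeasure L))
    {φ φ' : ι → VecL2 L M} (hφ : Orthonormal ℂ φ) (hφS : ∀ j, φ j ∈ S)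
    (hd : ∀ j, HasPeriodicWeakDeriv L (φ j) (φ' j))
    (hpot : ∀ j, Integrable (potentialDensity V (φ j) (φ j)) (periodMeasure L))
    {l : ι → ℝ} (hl : ∀ j, 0 ≤ l j)
    (heig : ∀ j, energyMatrix c φ φ' j j
      - ∫ x, potentialDensity V (φ j) (φ j) x ∂(periodMeasure L) = -(l j : ℂ)) :
    ∑ j, l j ^ γ ≤ Real.pi / √3 * K * semiclassicalConst γ
      * ∫ x, tracePow (V x) (γ + 1 / 2) ∂(periodMeasure L) := by
  classical
  obtain ⟨τ, hτs, hτ⟩ := exists_measure_lintegral_sub hγ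
  let χ : ι → ℝ → ℝ := fun j t => if t < l j then 1 else 0
  have hχ := fun j => integral_sub_mul_indicator hτ (l j)
  have hχχ : ∀ i j, Integrable (fun t => χ i t * χ j t) τ := fun i j => by
    refine (hχ i).1.mul_bdd (c := 1) (hχ j).1.aestronglyMeasurable (ae_of_all _ fun t => ?_)
    simp only [χ]
    split_ifs <;> simp
  let P : ι → ℝ := fun j => ∫ t, χ j t ∂τ
  let Q : ι → ℝ := fun j => ∫ t, χ j t * t ∂τ
  let R : ι → ι → ℝ := fun i j => ∫ t, χ i t * χ j t ∂τ
  have hRP : ∀ j, R j j = P j := fun j => by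
    refine integral_congr_ae (ae_of_all _ fun t => ?_)
    simp only [χ]
    split_ifs <;> simp
  have hPQ : ∀ j, P j * l j - Q j = l j ^ γ := fun j => by
    have := (hχ j).2.2
    rw [max_eq_left (hl j), mul_comm] at this
    exact this
  set a := energyMatrix c φ φ' with ha
  let Φ : ℝ → ℝ := fun x =>
    ∑ j, (P j * (potentialDensity V (φ j) (φ j) x).re - Q j * ‖φ j x‖ ^ 2)
      - ∑ i, ∑ j, R i j * (a i j * inner ℂ (φ j x) (φ i x)).re
  set C : ℝ := Real.pi / √3 * K * semiclassicalConst γ with hC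
  have hpt : ∀ᵐ x ∂(periodMeasure L), Φ x ≤ C * tracePow (V x) (γ + 1 / 2) := by
    filter_upwards [ae_forall_interpolation hS hφ hφS hd, hV] with x hx hVx
    have hA := hVx.isHermitian
    have h1 := trace_sub_energy_le hA hK (fun j => φ j x) a hx
    have h2 : ∀ t, ∑ j, (χ j t * (potentialDensity V (φ j) (φ j) x).re
          - χ j t * t * ‖φ j x‖ ^ 2)
        - ∑ i, ∑ j, χ i t * χ j t * (a i j * inner ℂ (φ j x) (φ i x)).re
        ≤ 2 * K / (3 * √3) * ∑ m, (max (hA.eigenvalues m - t) 0) ^ (3 / 2 : ℝ) := fun t => by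
      refine le_trans (le_of_eq ?_) (h1 (fun j => χ j t) (fun j => ?_) t)
      · congr 1
        refine Finset.sum_congr rfl fun j _ => ?_
        rw [potentialDensity]
        ring
      · simp only [χ]
        split_ifs <;> simp
    have h3 := fun m => integral_max_sub_rpow_three_halves hγ hτ (hVx.eigenvalues_nonneg m)
    have i1 : ∀ j, Integrable (fun t => χ j t * (potentialDensity V (φ j) (φ j) x).re
        - χ j t * t * ‖φ j x‖ ^ 2) τ := fun j =>
      ((hχ j).1.mul_const _).sub ((hχ j).2.1.mul_const _)
    have i2 : ∀ i j, Integrable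
        (fun t => χ i t * χ j t * (a i j * inner ℂ (φ j x) (φ i x)).re) τ := fun i j =>
      (hχχ i j).mul_const _
    have i3 := fun i => integrable_finsetSum Finset.univ fun j _ => i2 i j
    -- Integrating in `t` at fixed `x` replaces the cut-offs by the numbers `P`, `Q`, `R`; only
    -- finite sums then remain to be integrated in `x`.
    have h4 := integral_mono
      ((integrable_finsetSum Finset.univ fun j _ => i1 j).sub
        (integrable_finsetSum Finset.univ fun i _ => i3 i))
      ((integrable_finsetSum Finset.univ fun m _ => (h3 m).1).const_mul (2 * K / (3 * √3))) h2
    simp only [Pi.sub_apply] at h4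
    rw [integral_sub (integrable_finsetSum Finset.univ fun j _ => i1 j)
      (integrable_finsetSum Finset.univ fun i _ => i3 i), integral_finsetSum _ fun j _ => i1 j,
      integral_finsetSum _ fun i _ => i3 i, integral_const_mul,
      integral_finsetSum _ fun m _ => (h3 m).1] at h4
    have h5 : ∀ i, ∫ t, ∑ j, χ i t * χ j t * (a i j * inner ℂ (φ j x) (φ i x)).re ∂τ
        = ∑ j, R i j * (a i j * inner ℂ (φ j x) (φ i x)).re := fun i => by
      rw [integral_finsetSum _ fun j _ => i2 i j]
      exact Finset.sum_congr rfl fun j _ => integral_mul_const _ _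
    have h6 : ∀ j, ∫ t, (χ j t * (potentialDensity V (φ j) (φ j) x).re
        - χ j t * t * ‖φ j x‖ ^ 2) ∂τ
        = P j * (potentialDensity V (φ j) (φ j) x).re - Q j * ‖φ j x‖ ^ 2 := fun j => by
      rw [integral_sub ((hχ j).1.mul_const _) ((hχ j).2.1.mul_const _), integral_mul_const,
        integral_mul_const]
    simp only [h5, h6] at h4
    refine h4.trans_eq ?_
    rw [hA.tracePow_eq, Finset.mul_sum, Finset.mul_sum]
    refine Finset.sum_congr rfl fun m _ => ?_
    have h7 := (h3 m).2
    have hp : Real.pi ≠ 0 := Real.pi_ne_zero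
    rw [hC, semiclassicalConst]
    generalize ∫ t, (max (hA.eigenvalues m - t) 0) ^ (3 / 2 : ℝ) ∂τ = J at *
    generalize ∫ ξ : ℝ, (max (1 - ξ ^ 2) 0) ^ γ = I at *
    -- The constants combine as `2K/(3√3) · 3/4 = K/(2√3) = (π/√3) K (2π)⁻¹`.
    have h8 : J = 3 / 4 * (hA.eigenvalues m ^ (γ + 1 / 2) * I) := by linarith
    rw [h8]
    field_simp
    ring
  have j1 : ∀ j, Integrable (fun x => P j * (potentialDensity V (φ j) (φ j) x).re
      - Q j * ‖φ j x‖ ^ 2) (periodMeasure L) := fun j =>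
    ((hpot j).re.const_mul _).sub ((φ j).integrable_norm_sq.const_mul _)
  have j2' : ∀ i j, Integrable (fun x => a i j * inner ℂ (φ j x) (φ i x)) (periodMeasure L) :=
    fun i j => (L2.integrable_inner (φ j) (φ i)).const_mul _
  have j2 : ∀ i j, Integrable (fun x => R i j * (a i j * inner ℂ (φ j x) (φ i x)).re)
      (periodMeasure L) := fun i j => (j2' i j).re.const_mul _
  have j3 := fun i => integrable_finsetSum Finset.univ fun j _ => j2 i j
  have hΦi : Integrable Φ (periodMeasure L) :=
    (integrable_finsetSum Finset.univ fun j _ => j1 j).sub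
      (integrable_finsetSum Finset.univ fun i _ => j3 i)
  have hΦ : ∫ x, Φ x ∂(periodMeasure L) = ∑ j, l j ^ γ := by
    simp only [Φ]
    rw [integral_sub (integrable_finsetSum Finset.univ fun j _ => j1 j)
      (integrable_finsetSum Finset.univ fun i _ => j3 i), integral_finsetSum _ fun j _ => j1 j,
      integral_finsetSum _ fun i _ => j3 i, ← Finset.sum_sub_distrib]
    refine Finset.sum_congr rfl fun j _ => ?_
    have e1 : ∫ x, ∑ k, R j k * (a j k * inner ℂ (φ k x) (φ j x)).re ∂(periodMeasure L)
        = P j * (a j j).re := by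
      rw [integral_finsetSum _ fun k _ => j2 j k, Finset.sum_eq_single j]
      · rw [integral_const_mul, hRP]
        have := integral_re (j2' j j)
        simp only [RCLike.re_to_complex] at this
        rw [this, integral_const_mul, ← L2.inner_def, orthonormal_iff_ite.mp hφ, if_pos rfl,
          mul_one]
      · intro k _ hk
        rw [integral_const_mul]
        have := integral_re (j2' j k)
        simp only [RCLike.re_to_complex] at this
        rw [this, integral_const_mul, ← L2.inner_def, orthonormal_iff_ite.mp hφ, if_neg hk,
          mul_zero, Complex.zero_re, mul_zero]
      · exact fun h => absurd (Finset.mem_univ j) h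
    have e2 := integral_re (hpot j)
    simp only [RCLike.re_to_complex] at e2
    have e3 : (a j j).re - (∫ x, potentialDensity V (φ j) (φ j) x ∂(periodMeasure L)).re = -l j := by
      have := congrArg Complex.re (heig j)
      simpa using this
    have hre := (hpot j).re
    simp only [RCLike.re_to_complex] at hre
    rw [e1, integral_sub (hre.const_mul _) ((φ j).integrable_norm_sq.const_mul _),
      integral_const_mul, integral_const_mul, ← VecL2.norm_sq_eq_integral, hφ.1 j, ← hPQ, e2]
    linear_combination (-P j) * e3
  rw [← hΦ, ← integral_const_mul]
  exact integral_mono_ae hΦi (hT.const_mul _) hpt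

/-! ### Riesz means -/

theorem meanZeroProj_eq_self {L : ℝ} {M : ℕ} {u : VecL2 L M} (hu : u ∈ meanZeroSpace L M) :
    meanZeroProj L M u = u := by
  have h : meanValue L M u = 0 := hu
  simp [meanZeroProj, h]

theorem integral_potentialDensity_conj {M : ℕ} {μ : Measure ℝ} {V : ℝ → Matrix (Fin M) (Fin M) ℂ}
    (hV : ∀ᵐ x ∂μ, (V x).PosSemidef) (u w : ℝ → EuclideanSpace ℂ (Fin M)) :
    starRingEnd ℂ (∫ x, potentialDensity V u w x ∂μ) = ∫ x, potentialDensity V w u x ∂μ := by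
  rw [← integral_conj]
  refine integral_congr_ae (hV.mono fun x hx => ?_)
  simp only [potentialDensity]
  rw [← Complex.star_def, Matrix.star_dotProduct, Matrix.star_mulVec, hx.isHermitian.eq,
    ← Matrix.dotProduct_mulVec, star_star]

theorem mem_graphEigenspace_schrodingerGraph {L c : ℝ} {M : ℕ} {V : ℝ → Matrix (Fin M) (Fin M) ℂ}
    {S : Submodule ℂ (VecL2 L M)} {T : VecL2 L M →ₗ[ℂ] VecL2 L M} (hT : ∀ u ∈ S, T u = u)
    {E : ℝ} {u : VecL2 L M} (hu : u ∈ graphEigenspace (schrodingerGraph L c V S T) E) :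
    u ∈ S ∧ ∃ u' : VecL2 L M, HasPeriodicWeakDeriv L u u' ∧
      ∀ w w' : VecL2 L M, w ∈ S → HasPeriodicWeakDeriv L w w' →
        Integrable (potentialDensity V w u) (periodMeasure L) ∧
        inner ℂ w' u' + (c : ℂ) * inner ℂ w u - ∫ x, potentialDensity V w u x ∂(periodMeasure L)
          = E * inner ℂ w u := by
  obtain ⟨hS, -, u', hu', H⟩ : u ∈ S ∧ (E : ℂ) • u ∈ S ∧ ∃ u' : VecL2 L M,
      HasPeriodicWeakDeriv L u u' ∧ ∀ w w' : VecL2 L M, w ∈ S → HasPeriodicWeakDeriv L w w' →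
        Integrable (potentialDensity V (T w) (T u)) (periodMeasure L) ∧
        inner ℂ w' u' + (c : ℂ) * inner ℂ w u
          - ∫ x, potentialDensity V (T w) (T u) x ∂(periodMeasure L) = inner ℂ w ((E : ℂ) • u) := hu
  refine ⟨hS, u', hu', fun w w' hw hw' => ?_⟩
  have h := H w w' hw hw'
  rwa [hT u hS, hT w hw, inner_smul_right] at h

/-- The form is symmetric: test the equation of `u` with `w`, that of `w` with `u`, conjugate one
and subtract. -/
theorem inner_eq_zero_of_eigenvalue_ne {L c : ℝ} {M : ℕ} {V : ℝ → Matrix (Fin M) (Fin M) ℂ}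
    (hV : ∀ᵐ x ∂(periodMeasure L), (V x).PosSemidef) {S : Submodule ℂ (VecL2 L M)}
    {T : VecL2 L M →ₗ[ℂ] VecL2 L M} (hT : ∀ u ∈ S, T u = u) {E F : ℝ} (hEF : E ≠ F)
    {u w : VecL2 L M} (hu : u ∈ graphEigenspace (schrodingerGraph L c V S T) E)
    (hw : w ∈ graphEigenspace (schrodingerGraph L c V S T) F) : inner ℂ u w = 0 := by
  obtain ⟨hSu, u', hu', Hu⟩ := mem_graphEigenspace_schrodingerGraph hT hu
  obtain ⟨hSw, w', hw', Hw⟩ := mem_graphEigenspace_schrodingerGraph hT hw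
  have h1 := (Hu w w' hSw hw').2
  have h2 := congrArg (starRingEnd ℂ) (Hw u u' hSu hu').2
  simp only [map_sub, map_add, map_mul, inner_conj_symm, Complex.conj_ofReal,
    integral_potentialDensity_conj hV] at h2
  have h3 : ((E : ℂ) - F) * inner ℂ w u = 0 := by linear_combination h2 - h1
  have h4 : (E : ℂ) - F ≠ 0 := by
    rw [sub_ne_zero]
    exact_mod_cast hEF
  rw [← inner_conj_symm, (mul_eq_zero.mp h3).resolve_left h4, map_zero]

theorem exists_orthonormal_of_le_rank {H : Type*} [NormedAddCommGroup H] [InnerProductSpace ℂ H]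
    (W : Submodule ℂ H) {n : ℕ} (hn : (n : ℕ∞) ≤ Cardinal.toENat (Module.rank ℂ W)) :
    ∃ v : Fin n → H, Orthonormal ℂ v ∧ ∀ i, v i ∈ W := by
  rw [Cardinal.natCast_le_toENat] at hn
  obtain ⟨v, hv⟩ := Module.le_rank_iff.mp hn
  exact ⟨fun i => (InnerProductSpace.gramSchmidtNormed ℂ v i : W),
    (InnerProductSpace.gramSchmidtNormed_orthonormal hv).comp_linearIsometry W.subtypeₗᵢ,
    fun i => Subtype.coe_prop _⟩

theorem rieszMean_le_of_finite {H : Type*} [AddCommGroup H] [Module ℂ H] {γ B : ℝ}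
    {A : Submodule ℂ (H × H)}
    (h : ∀ (s : Finset (Set.Iio (0 : ℝ))) (n : Set.Iio (0 : ℝ) → ℕ),
      (∀ E, (n E : ℕ∞) ≤ Cardinal.toENat (Module.rank ℂ (graphEigenspace A E))) →
      ∑ E ∈ s, n E * (-(E : ℝ)) ^ γ ≤ B) :
    rieszMean γ A ≤ ENNReal.ofReal B := by
  classical
  have hfin : ∀ E : Set.Iio (0 : ℝ), Cardinal.toENat (Module.rank ℂ (graphEigenspace A E)) ≠ ⊤ := by
    intro E hE
    have hpos : 0 < (-(E : ℝ)) ^ γ := Real.rpow_pos_of_pos (neg_pos.mpr E.2) _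
    -- An infinite multiplicity would allow enough copies of a single eigenvalue to exceed `B`.
    obtain ⟨N, hN⟩ := exists_nat_gt (B / (-(E : ℝ)) ^ γ)
    have := h {E} (fun F => if F = E then N else 0) (fun F => by
      split_ifs with hF
      · rw [hF, hE]
        exact le_top
      · simp)
    rw [Finset.sum_singleton, if_pos rfl] at this
    rw [div_lt_iff₀ hpos] at hN
    linarith
  rw [rieszMean, ENNReal.tsum_eq_iSup_sum]
  refine iSup_le fun s => ?_
  have hb := h s (fun E => (Cardinal.toENat (Module.rank ℂ (graphEigenspace A E))).toNat)
    fun E => (ENat.natCast_toNat (hfin E)).le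
  refine le_trans (le_of_eq ?_) (ENNReal.ofReal_le_ofReal hb)
  rw [ENNReal.ofReal_sum_of_nonneg fun E _ =>
    mul_nonneg (Nat.cast_nonneg _) (Real.rpow_nonneg (neg_nonneg.mpr E.2.le) _)]
  refine Finset.sum_congr rfl fun E _ => ?_
  rw [ENNReal.ofReal_mul (Nat.cast_nonneg _), ENNReal.ofReal_natCast]
  congr 1
  conv_lhs => rw [← ENat.natCast_toNat (hfin E)]
  simp

theorem rieszMean_schrodingerGraph_le {L c K γ : ℝ} {M : ℕ} (hγ : 1 ≤ γ) (hK : 0 ≤ K)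
    {S : Submodule ℂ (VecL2 L M)} (hS : VectorInterpolation L c K S)
    {T : VecL2 L M →ₗ[ℂ] VecL2 L M} (hT : ∀ u ∈ S, T u = u)
    {V : ℝ → Matrix (Fin M) (Fin M) ℂ} (hV : ∀ᵐ x ∂(periodMeasure L), (V x).PosSemidef)
    (hVi : Integrable (fun x => tracePow (V x) (γ + 1 / 2)) (periodMeasure L)) :
    rieszMean γ (schrodingerGraph L c V S T) ≤ ENNReal.ofReal
      (Real.pi / √3 * K * semiclassicalConst γ
        * ∫ x, tracePow (V x) (γ + 1 / 2) ∂(periodMeasure L)) := by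
  classical
  refine rieszMean_le_of_finite fun s n hn => ?_
  choose v hv hvW using fun E => exists_orthonormal_of_le_rank _ (hn E)
  let φ : (Σ E : s, Fin (n E)) → VecL2 L M := fun p => v p.1 p.2
  have hmem : ∀ p, φ p ∈ graphEigenspace (schrodingerGraph L c V S T) p.1 := fun p => hvW _ _
  have hφ : Orthonormal ℂ φ := by
    refine ⟨fun p => (hv p.1).1 p.2, ?_⟩
    rintro ⟨E, i⟩ ⟨F, j⟩ hne
    by_cases hEF : E = F
    · subst hEF
      exact (hv E).2 fun h : i = j => hne (by rw [h])
    · refine inner_eq_zero_of_eigenvalue_ne hV hT (fun h => hEF ?_) (hvW E i) (hvW F j)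
      exact Subtype.ext (Subtype.ext h)
  have hm : ∀ p, φ p ∈ S ∧ ∃ u' : VecL2 L M, HasPeriodicWeakDeriv L (φ p) u' ∧
      Integrable (potentialDensity V (φ p) (φ p)) (periodMeasure L) ∧
      inner ℂ u' u' + (c : ℂ) * inner ℂ (φ p) (φ p)
        - ∫ x, potentialDensity V (φ p) (φ p) x ∂(periodMeasure L)
        = ((p.1 : ℝ) : ℂ) := fun p => by
    obtain ⟨hSu, u', hu', Hu⟩ := mem_graphEigenspace_schrodingerGraph hT (hmem p)
    obtain ⟨h1, h2⟩ := Hu (φ p) u' hSu hu'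
    refine ⟨hSu, u', hu', h1, h2.trans ?_⟩
    rw [orthonormal_iff_ite.mp hφ, if_pos rfl, mul_one]
  choose hφS φ' hd hpot heig using hm
  have hsum := sum_rpow_le_of_eigenfamily hγ hK hS hV hVi hφ hφS hd hpot
    (l := fun p => -((p.1 : Set.Iio (0 : ℝ)) : ℝ)) (fun p => neg_nonneg.mpr (p.1 : Set.Iio (0 : ℝ)).2.le)
    (fun p => by
      rw [energyMatrix, heig p]
      push_cast
      ring)
  refine le_trans (le_of_eq ?_) hsum
  rw [Fintype.sum_sigma]
  simp only [Finset.sum_const, Finset.card_univ, Fintype.card_fin, nsmul_eq_mul]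
  exact (Finset.sum_coe_sort s fun E => (n E : ℝ) * (-(E : ℝ)) ^ γ).symm

/-- Pass to the limit along admissible constants tending to the infimum. Nonemptiness is essential:
the infimum of the empty set is `0` by convention. -/
theorem le_ofReal_mul_sInf {A : Set ℝ} (hA : A.Nonempty) (h0 : ∀ K ∈ A, 0 ≤ K) {X : ℝ≥0∞}
    {a b c : ℝ} (h : ∀ K ∈ A, X ≤ ENNReal.ofReal (a * K * b * c)) :
    X ≤ ENNReal.ofReal (a * sInf A * b * c) := by
  obtain ⟨u, _, hu, hmem⟩ := exists_seq_tendsto_sInf hA ⟨0, h0⟩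
  exact ge_of_tendsto' (ENNReal.tendsto_ofReal (((hu.const_mul a).mul_const b).mul_const c))
    fun n => h _ (hmem n)

theorem mainTheorem6 (M : ℕ) (γ : ℝ) (hγ : 1 ≤ γ) :
    (∀ (α β : ℝ), 0 < α → 0 < β →
      ∀ V : ℝ → Matrix (Fin M) (Fin M) ℂ,
        (∀ i j, AEMeasurable (fun x => V x i j) (periodMeasure (2 * Real.pi / α))) →
        (∀ᵐ x ∂(periodMeasure (2 * Real.pi / α)), (V x).PosSemidef) →
        Integrable (fun x => tracePow (V x) (γ + 1 / 2)) (periodMeasure (2 * Real.pi / α)) →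
        rieszMean γ (H1 α β V) ≤ ENNReal.ofReal
          (Real.pi / √3 * K1 β * semiclassicalConst γ
            * ∫ x, tracePow (V x) (γ + 1 / 2) ∂(periodMeasure (2 * Real.pi / α)))) ∧
    (∀ δ : ℝ, 0 ≤ δ → δ < 1 →
      ∀ V : ℝ → Matrix (Fin M) (Fin M) ℂ,
        (∀ i j, AEMeasurable (fun x => V x i j) (periodMeasure (2 * Real.pi))) →
        (∀ᵐ x ∂(periodMeasure (2 * Real.pi)), (V x).PosSemidef) →
        Integrable (fun x => tracePow (V x) (γ + 1 / 2)) (periodMeasure (2 * Real.pi)) →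
        rieszMean γ (H2 δ V) ≤ ENNReal.ofReal
          (Real.pi / √3 * K2 δ * semiclassicalConst γ
            * ∫ x, tracePow (V x) (γ + 1 / 2) ∂(periodMeasure (2 * Real.pi)))) := by
  refine ⟨fun α β hα hβ V _ hV hVi => ?_, fun δ hδ hδ1 V _ hV hVi => ?_⟩
  · refine le_ofReal_mul_sInf (firstAdmissible_one_nonempty hβ) (fun K hK => hK.1) fun K hK => ?_
    -- `K1` is defined at period `2π`; scaling carries its admissible constants to period `2π/α`.
    exact rieszMean_schrodingerGraph_le hγ hK.1 (vectorInterpolation_of_mem_firstAdmissible hβ.le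
      (firstAdmissible_subset one_pos hα β hK)) (fun u _ => rfl) hV hVi
  · refine le_ofReal_mul_sInf (secondAdmissible_nonempty hδ hδ1) (fun K hK => hK.1) fun K hK => ?_
    exact rieszMean_schrodingerGraph_le hγ hK.1
      (vectorInterpolation_of_mem_secondAdmissible hδ1.le hK)
      (fun u hu => meanZeroProj_eq_self hu) hV hVi
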